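/- Let $\widetilde Q$ be a probability distribution on $\mathbb{R}$ with $$\int x\,\widetilde Q(dx)=0,\qquad \int x^2\,\widetilde Q(dx)=1,\qquad \widetilde b:=\int x^4\,\widetilde Q(dx)<\infty .$$ For each $N\ge 1$ let $\widetilde X_N=(\widetilde X_{ij})_{i,j=1,\dots,N}$ be the associated real-symmetric Wigner matrix: $\widetilde X_{ij}=\widetilde X_{ji}=\xi_{ij}$ for $i<j$ and $\widetilde X_{ii}=\sqrt2\,\xi_{ii}$, where $(\xi_{ij})_{1\le i\le j\le N}$ are i.i.d. real random variables with distribution $\widetilde Q$. Put $$\widetilde f_N(\mu,\nu):=\mathbb{E}\big(\det(\widetilde X_N-\mu)\,\det(\widetilde X_N-\nu)\big)\qquad(\mu,\nu\in\mathbb{R}),$$ where the random variable under the expectation is integrable. Let $\mathrm{Ai}$ denote the Airy function, and for $\mu\ne\nu$ let $$\mathbb{B}(\mu,\nu):=\frac{(\mu+\nu)\,\mathrm{Ai}(\mu)\mathrm{Ai}(\nu)-2\,\mathrm{Ai}'(\mu)\mathrm{Ai}'(\nu)}{(\mu-\nu)^2}+\frac{2\,\mathrm{Ai}(\mu)\mathrm{Ai}'(\nu)-2\,\mathrm{Ai}'(\mu)\mathrm{Ai}(\nu)}{(\mu-\nu)^3}.$$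 Then $\mathbb{B}$ extends continuously to $\mathbb{R}^2$ (and $\mathbb{B}(\mu,\mu)$ denotes the value of this extension), and for all $\mu,\nu\in\mathbb{R}$ $$\lim_{N\to\infty}\frac{\widetilde f_N\big(2\sqrt N+\mu/N^{1/6},\;2\sqrt N+\nu/N^{1/6}\big)}{\sqrt{2\pi}\,N!\,N^{1/2}\exp\big(2N+(\mu+\nu)N^{1/3}\big)}=\exp\Big(\frac{\widetilde b-3}{2}\Big)\,\mathbb{B}(\mu,\nu).$$ Moreover, for all $x\neq y$, $$\mathbb{B}(x,y)=\frac{1}{x-y}\Big(\frac{\partial}{\partial y}-\frac{\partial}{\partial x}\Big)\mathbb{A}(x,y),\qquad \mathbb{A}(x,y):=\frac{\mathrm{Ai}(x)\mathrm{Ai}'(y)-\mathrm{Ai}'(x)\mathrm{Ai}(y)}{x-y}.$$ -/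

import Mathlib

open MeasureTheory ProbabilityTheory Filter Topology

noncomputable section

/-- The Airy function on the real line,
`Ai x = (1 / (2 π i)) ∫ exp (z ^ 3 / 3 - x z) dz`, where the contour is the vertical line
`z = 1 + i t`, `t ∈ ℝ`, on which the integral converges absolutely. Its value is a real number,
since `t` and `-t` give conjugate integrands. -/
def airyAi (x : ℝ) : ℝ :=
  (1 / (2 * Real.pi)) *
    (∫ t : ℝ, Complex.exp ((1 + t * Complex.I) ^ 3 / 3 - x * (1 + t * Complex.I))).re

/-- The derivative `Ai'` of the Airy function. -/
def airyAiDeriv (x : ℝ) : ℝ := deriv airyAi x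

/-- The Airy kernel `𝔸 (μ, ν)` away from the diagonal. -/
def airyKernel (μ ν : ℝ) : ℝ :=
  (airyAi μ * airyAiDeriv ν - airyAiDeriv μ * airyAi ν) / (μ - ν)

/-- The explicit formula for the kernel `𝔹 (μ, ν)`, meaningful for `μ ≠ ν`. -/
def airyKernelTwoFormula (μ ν : ℝ) : ℝ :=
  ((μ + ν) * airyAi μ * airyAi ν - 2 * airyAiDeriv μ * airyAiDeriv ν) / (μ - ν) ^ 2
    + (2 * airyAi μ * airyAiDeriv ν - 2 * airyAiDeriv μ * airyAi ν) / (μ - ν) ^ 3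

open Classical in
/-- The kernel `𝔹 (μ, ν)`: the explicit formula for `μ ≠ ν`, extended to the diagonal by its
limit along off-diagonal points. -/
def airyKernelTwo (μ ν : ℝ) : ℝ :=
  if μ = ν then
    limUnder (𝓝[{p : ℝ × ℝ | p.1 ≠ p.2}] (μ, ν)) (fun p => airyKernelTwoFormula p.1 p.2)
  else airyKernelTwoFormula μ ν

/-- The real-symmetric `N × N` matrix built from the numbers `ξ i j` with `i ≤ j`
(the values `ξ i j` with `i > j` are not used). -/
def symmetricMatrix {N : ℕ} (ξ : Fin N → Fin N → ℝ) : Matrix (Fin N) (Fin N) ℝ :=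
  Matrix.of fun i j =>
    if i < j then ξ i j
    else if i = j then Real.sqrt 2 * ξ i i
    else ξ j i

/-- The random variables `ξ i j`, `i ≤ j`, are i.i.d. with distribution `Q`. -/
structure IsIIDUpperTriangle {N : ℕ} {Ω : Type*} [MeasurableSpace Ω]
    (P : Measure Ω) (Q : Measure ℝ) (ξ : Fin N → Fin N → Ω → ℝ) : Prop where
  hasLaw : ∀ i j, i ≤ j → HasLaw (ξ i j) Q P
  indep : iIndepFun
    (fun (p : {p : Fin N × Fin N // p.1 ≤ p.2}) => ξ p.1.1 p.1.2) P

/-- The characteristic polynomial `D (lam) = det (X - lam)` of the matrix `X` built from `ξ`,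
as a random variable. -/
def wignerCharDet {N : ℕ} {Ω : Type*} (ξ : Fin N → Fin N → Ω → ℝ) (lam : ℝ) (ω : Ω) : ℝ :=
  (symmetricMatrix (fun i j => ξ i j ω) - lam • (1 : Matrix (Fin N) (Fin N) ℝ)).det

/-- The second-order correlation function `f (μ, ν) = 𝔼 (D (μ) D (ν))`. -/
def corrFun {N : ℕ} {Ω : Type*} [MeasurableSpace Ω] (P : Measure Ω)
    (ξ : Fin N → Fin N → Ω → ℝ) (μ ν : ℝ) : ℝ :=
  ∫ ω, wignerCharDet ξ μ ω * wignerCharDet ξ ν ω ∂P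

/-- The normalizing constant
`(√(2π) · N! · N^(1/2) · exp (2 N + (μ + ν) N^(1/3)))⁻¹`. -/
def edgeNormalization (N : ℕ) (μ ν : ℝ) : ℝ :=
  (Real.sqrt (2 * Real.pi) * (N.factorial : ℝ) * (N : ℝ) ^ (1 / 2 : ℝ)
    * Real.exp (2 * (N : ℝ) + (μ + ν) * (N : ℝ) ^ (1 / 3 : ℝ)))⁻¹

/-- The edge scaling `2 √N + x / N^(1/6)`. -/
def edgePoint (N : ℕ) (x : ℝ) : ℝ :=
  2 * Real.sqrt (N : ℝ) + x / (N : ℝ) ^ (1 / 6 : ℝ)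

end

noncomputable section

/-! ### Hermite polynomials and their Christoffel–Darboux sums -/

section Hermite

/-! The correlation function has an exact finite formula, and the edge limit is read off from it.
Write `f_n` for the correlation function in dimension `n`, `c_n = f_n / n!` and `a = (b - 3) / 2`.
Expanding both determinants along the first row and column, which are independent of the remaining
minor, and averaging over that row leaves expectations of determinants and cofactors in dimension
`n`. Except for the contribution of the fourth cumulant, these are derivatives or divided
differences of `f_n`; the cumulant multiplies a sum of diagonal cofactors, each of which gives
`f_{n-1}`. The result is `(n + 1) c_{n+1} = L c_n + 2 a c_{n-1}`, with `L = 2 + x y - x ∂_y - y ∂_x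
+ ∂_x ∂_y + 2 (∂_x - ∂_y) / (y - x)`.

Let `P_j = He_j(x) He_j(y) / j!`, `S_n = ∑_{j<n} P_j` and `T_n = ∑_{m<n} S_m`. The
Christoffel–Darboux formula yields `L T_p = (p - 1) T_{p+1}`, so the recursion is solved by `c_n =
∑_k a^k / k! · T_{n+2-2k}` (`corrStep_corrPoly`, `corrFun_eq_corrPoly`).

At the edge, the contour integral for `He_N` has a double saddle point, and the rescaled Hermite
polynomials converge to `Ai` locally uniformly on `ℂ` (`tendsto_hermiteEdge`). Derivatives then
converge as well, and Hermite's equation turns into Airy's. A Christoffel–Darboux identity for `T_N`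
gives convergence to the kernel `𝔹` off the diagonal; the maximum principle in one variable carries
it across the diagonal and makes the limit continuous (`uniformCauchySeqOn_edgeSumTwo`).

Finally, changing the index of `T` by a bounded amount costs only a few sums `S`, which are of
smaller order, so for each fixed `k` the sums `T_{N+2-2k}` have the same limit. Dominated
convergence in `k` sums the coefficients to `exp a` (`tendsto_edge_corrPoly`). -/

theorem derivative_hermite_succ (n : ℕ) :
    Polynomial.derivative (Polynomial.hermite (n + 1))
      = ((n : Polynomial ℤ) + 1) * Polynomial.hermite n := by
  induction n with
  | zero => simp
  | succ n ih =>
    rw [Polynomial.hermite_succ (n + 1), Polynomial.derivative_sub, Polynomial.derivative_mul, ih]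
    simp only [Polynomial.derivative_X, Polynomial.derivative_mul, Polynomial.derivative_add,
      Polynomial.derivative_natCast, Polynomial.derivative_one, one_mul, add_zero, zero_mul,
      zero_add, Nat.cast_succ]
    rw [Polynomial.hermite_succ n]
    ring

/-- The value at `x` of the `n`-th (probabilists') Hermite polynomial. -/
def hermiteVal {R : Type*} [CommRing R] (n : ℕ) (x : R) : R :=
  Polynomial.aeval x (Polynomial.hermite n)

/-- The value at `x` of the derivative of the `n`-th Hermite polynomial. -/
def hermiteDer {R : Type*} [CommRing R] (n : ℕ) (x : R) : R :=
  Polynomial.aeval x (Polynomial.derivative (Polynomial.hermite n))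

variable {R : Type*} [CommRing R]

@[simp] theorem hermiteVal_zero (x : R) : hermiteVal 0 x = 1 := by
  simp [hermiteVal]

@[simp] theorem hermiteDer_zero (x : R) : hermiteDer 0 x = 0 := by
  simp [hermiteDer]

theorem hermiteVal_succ (n : ℕ) (x : R) :
    hermiteVal (n + 1) x = x * hermiteVal n x - hermiteDer n x := by
  simp [hermiteVal, hermiteDer, Polynomial.hermite_succ]

theorem hermiteDer_succ (n : ℕ) (x : R) :
    hermiteDer (n + 1) x = (n + 1) * hermiteVal n x := by
  simp [hermiteVal, hermiteDer, derivative_hermite_succ, -Polynomial.hermite_succ]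

theorem hermiteVal_ofReal (n : ℕ) (x : ℝ) :
    hermiteVal n (x : ℂ) = ((hermiteVal n x : ℝ) : ℂ) := by
  have := Polynomial.aeval_algebraMap_apply ℂ x (Polynomial.hermite n)
  simpa [hermiteVal] using this

theorem hasDerivAt_hermiteVal {𝕜 : Type*} [NontriviallyNormedField 𝕜] (n : ℕ) (x : 𝕜) :
    HasDerivAt (hermiteVal n) (hermiteDer n x) x :=
  Polynomial.hasDerivAt_aeval _ _

theorem hasDerivAt_hermiteDer {𝕜 : Type*} [NontriviallyNormedField 𝕜] (n : ℕ) (x : 𝕜) :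
    HasDerivAt (hermiteDer n) (x * hermiteDer n x - n * hermiteVal n x) x := by
  cases n with
  | zero =>
    have : (hermiteDer 0 : 𝕜 → 𝕜) = fun _ => 0 := by ext; simp
    rw [this]
    simpa using hasDerivAt_const x (0 : 𝕜)
  | succ n =>
    have : (hermiteDer (n + 1) : 𝕜 → 𝕜) = fun x => ((n : 𝕜) + 1) * hermiteVal n x := by
      ext; rw [hermiteDer_succ]
    rw [this]
    refine ((hasDerivAt_hermiteVal n x).const_mul ((n : 𝕜) + 1)).congr_deriv ?_
    beta_reduce
    rw [hermiteVal_succ]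
    push_cast
    ring

end Hermite

section ChristoffelDarboux

variable {F : Type*} [Field F]

/-- `He_j(x) He_j(y) / j!`. -/
def hermiteProd (j : ℕ) (x y : F) : F := hermiteVal j x * hermiteVal j y / (j.factorial : F)

/-- The Christoffel–Darboux sum `∑_{j < n} He_j(x) He_j(y) / j!`. -/
def hermiteSum (n : ℕ) (x y : F) : F := ∑ j ∈ Finset.range n, hermiteProd j x y

/-- The iterated sum `∑_{m < n} ∑_{j < m} He_j(x) He_j(y) / j!`. -/
def hermiteSumTwo (n : ℕ) (x y : F) : F := ∑ m ∈ Finset.range n, hermiteSum m x y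

theorem hermiteSum_succ (n : ℕ) (x y : F) :
    hermiteSum (n + 1) x y = hermiteSum n x y + hermiteProd n x y :=
  Finset.sum_range_succ _ _

theorem hermiteSumTwo_succ (n : ℕ) (x y : F) :
    hermiteSumTwo (n + 1) x y = hermiteSumTwo n x y + hermiteSum n x y :=
  Finset.sum_range_succ _ _

@[simp] theorem hermiteSum_zero (x y : F) : hermiteSum 0 x y = 0 := Finset.sum_range_zero _
@[simp] theorem hermiteSumTwo_zero (x y : F) : hermiteSumTwo 0 x y = 0 := Finset.sum_range_zero _
@[simp] theorem hermiteSumTwo_one (x y : F) : hermiteSumTwo 1 x y = 0 := by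
  rw [hermiteSumTwo_succ]; simp

theorem factorial_mul_hermiteProd [CharZero F] (n : ℕ) (x y : F) :
    (n.factorial : F) * hermiteProd n x y = hermiteVal n x * hermiteVal n y := by
  have : (n.factorial : F) ≠ 0 := by exact_mod_cast n.factorial_ne_zero
  unfold hermiteProd
  field_simp

/-- The Christoffel–Darboux formula. -/
theorem factorial_mul_hermiteSum [CharZero F] (n : ℕ) (x y : F) :
    (n.factorial : F) * hermiteSum n x y * (x - y)
      = hermiteVal n x * hermiteDer n y - hermiteDer n x * hermiteVal n y := by
  induction n with
  | zero => simp
  | succ n ih =>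
    have h := factorial_mul_hermiteProd n x y
    rw [hermiteSum_succ, Nat.factorial_succ, hermiteVal_succ, hermiteVal_succ, hermiteDer_succ,
      hermiteDer_succ]
    push_cast
    linear_combination ((n : F) + 1) * ih + ((n : F) + 1) * (x - y) * h

/-- The Christoffel–Darboux formula on the diagonal. -/
theorem factorial_mul_hermiteSum_self [CharZero F] (n : ℕ) (x : F) :
    (n.factorial : F) * hermiteSum n x x
      = hermiteDer n x ^ 2 - hermiteVal n x * (x * hermiteDer n x - n * hermiteVal n x) := by
  induction n with
  | zero => simp
  | succ n ih =>
    have h := factorial_mul_hermiteProd n x x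
    rw [hermiteSum_succ, Nat.factorial_succ, hermiteVal_succ, hermiteDer_succ]
    push_cast
    linear_combination ((n : F) + 1) * ih + ((n : F) + 1) * h

/-- The analogue of the Christoffel–Darboux formula for the iterated sum. -/
theorem factorial_mul_hermiteSumTwo [CharZero F] (n : ℕ) (x y : F) :
    (n.factorial : F) * hermiteSumTwo n x y * (x - y) ^ 3
      = (x - y) * ((x * hermiteDer n x - n * hermiteVal n x) * hermiteVal n y
          + hermiteVal n x * (y * hermiteDer n y - n * hermiteVal n y)
          - 2 * hermiteDer n x * hermiteDer n y)
        + 2 * (hermiteVal n x * hermiteDer n y - hermiteDer n x * hermiteVal n y) := by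
  induction n with
  | zero => simp
  | succ n ih =>
    have h := factorial_mul_hermiteSum n x y
    rw [hermiteSumTwo_succ, Nat.factorial_succ, hermiteVal_succ, hermiteVal_succ, hermiteDer_succ,
      hermiteDer_succ]
    push_cast
    -- The new summand `hermiteSum n x y` times `(x - y) ^ 3` is `(x - y) ^ 2` times the
    -- Christoffel–Darboux formula.
    linear_combination ((n : F) + 1) * ih + ((n : F) + 1) * (x - y) ^ 2 * h

/-- Summation by parts: the `i`-th product occurs in `p - i` of the sums of length at most `p`, so
the iterated sum has weights `p - i` and the difference on the right has weights `i`. -/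
theorem sum_range_mul_hermiteProd (p : ℕ) (x y : F) :
    ∑ j ∈ Finset.range p, ((j : F) + 1) * hermiteProd (j + 1) x y
      = p * hermiteSum (p + 1) x y - hermiteSumTwo (p + 1) x y := by
  induction p with
  | zero => simp
  | succ p ih =>
    rw [Finset.sum_range_succ, ih, hermiteSumTwo_succ (p + 1), hermiteSum_succ (p + 1)]
    push_cast
    ring

end ChristoffelDarboux

/-! ### The one-dimension step on Christoffel–Darboux sums -/

section CorrStep

/-- `CorrStep G R` says that the second-order differential operator which advances the Gaussian
second-order correlation function by one dimension sends `G` to `R`. -/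
def CorrStep (G R : ℝ → ℝ → ℝ) : Prop :=
  ∃ Gx Gy Gxy T : ℝ → ℝ → ℝ,
    (∀ x y, HasDerivAt (fun s => G s y) (Gx x y) x) ∧
    (∀ x y, HasDerivAt (fun t => G x t) (Gy x y) y) ∧
    (∀ x y, HasDerivAt (fun s => Gy s y) (Gxy x y) x) ∧
    (∀ x y, (y - x) * T x y = Gx x y - Gy x y) ∧
    ∀ x y, R x y = (2 + x * y) * G x y - x * Gy x y - y * Gx x y + Gxy x y + 2 * T x y

theorem CorrStep.zero : CorrStep 0 0 :=
  ⟨0, 0, 0, 0, fun _ _ => hasDerivAt_const _ _, fun _ _ => hasDerivAt_const _ _,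
    fun _ _ => hasDerivAt_const _ _, fun _ _ => by simp, fun _ _ => by simp⟩

theorem CorrStep.add {G R G' R' : ℝ → ℝ → ℝ} (h : CorrStep G R) (h' : CorrStep G' R') :
    CorrStep (G + G') (R + R') := by
  obtain ⟨Gx, Gy, Gxy, T, h1, h2, h3, h4, h5⟩ := h
  obtain ⟨Gx', Gy', Gxy', T', h1', h2', h3', h4', h5'⟩ := h'
  refine ⟨Gx + Gx', Gy + Gy', Gxy + Gxy', T + T', fun x y => (h1 x y).add (h1' x y),
    fun x y => (h2 x y).add (h2' x y), fun x y => (h3 x y).add (h3' x y), fun x y => ?_,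
    fun x y => ?_⟩
  · simp only [Pi.add_apply]; linear_combination h4 x y + h4' x y
  · simp only [Pi.add_apply]; linear_combination h5 x y + h5' x y

theorem CorrStep.const_smul {G R : ℝ → ℝ → ℝ} (c : ℝ) (h : CorrStep G R) :
    CorrStep (c • G) (c • R) := by
  obtain ⟨Gx, Gy, Gxy, T, h1, h2, h3, h4, h5⟩ := h
  refine ⟨c • Gx, c • Gy, c • Gxy, c • T, fun x y => (h1 x y).const_mul c,
    fun x y => (h2 x y).const_mul c, fun x y => (h3 x y).const_mul c, fun x y => ?_,
    fun x y => ?_⟩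
  · simp only [Pi.smul_apply, smul_eq_mul]; linear_combination c * h4 x y
  · simp only [Pi.smul_apply, smul_eq_mul]; linear_combination c * h5 x y

theorem CorrStep.sum {ι : Type*} (s : Finset ι) {G R : ι → ℝ → ℝ → ℝ}
    (h : ∀ i ∈ s, CorrStep (G i) (R i)) : CorrStep (∑ i ∈ s, G i) (∑ i ∈ s, R i) := by
  classical
  induction s using Finset.induction_on with
  | empty => simpa using CorrStep.zero
  | insert a s ha ih =>
    rw [Finset.sum_insert ha, Finset.sum_insert ha]
    exact (h a (Finset.mem_insert_self _ _)).add
      (ih fun i hi => h i (Finset.mem_insert_of_mem hi))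

/-- The divided difference of the two partial derivatives is `hermiteSum j`, by Christoffel–Darboux.
The terms without the constant `2` factor as `(x He_j - He_j')(x) · (y He_j - He_j')(y) / j!`, where
each bracket is `He_{j+1}`. -/
theorem corrStep_hermiteProd (j : ℕ) :
    CorrStep (hermiteProd j) (fun x y => 2 * hermiteProd j x y
      + (j + 1) * hermiteProd (j + 1) x y + 2 * hermiteSum j x y) := by
  have hf : (j.factorial : ℝ) ≠ 0 := by exact_mod_cast j.factorial_ne_zero
  have hj : (j : ℝ) + 1 ≠ 0 := by positivity
  refine ⟨fun x y => hermiteDer j x * hermiteVal j y / j.factorial,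
    fun x y => hermiteVal j x * hermiteDer j y / j.factorial,
    fun x y => hermiteDer j x * hermiteDer j y / j.factorial, hermiteSum j, fun x y => ?_,
    fun x y => ?_, fun x y => ?_, fun x y => ?_, fun x y => ?_⟩
  · exact ((hasDerivAt_hermiteVal j x).mul_const _).div_const _
  · exact ((hasDerivAt_hermiteVal j y).const_mul _).div_const _
  · exact ((hasDerivAt_hermiteVal j x).mul_const _).div_const _
  · have := factorial_mul_hermiteSum j x y
    rw [div_sub_div_same, eq_div_iff hf]
    linear_combination -this
  · unfold hermiteProd
    simp only [Nat.factorial_succ, hermiteVal_succ]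
    push_cast
    field_simp
    ring

theorem corrStep_hermiteSum (p : ℕ) :
    CorrStep (hermiteSum p) (fun x y => hermiteSum p x y + p * hermiteSum (p + 1) x y
      + hermiteSumTwo p x y) := by
  have h := CorrStep.sum (Finset.range p) (fun j _ => corrStep_hermiteProd j)
  convert h using 1
  · ext x y
    simp [hermiteSum]
  · ext x y
    have := sum_range_mul_hermiteProd p x y
    simp only [Finset.sum_apply, Finset.sum_add_distrib, this, ← Finset.mul_sum]
    change _ = 2 * hermiteSum p x y + _ + 2 * hermiteSumTwo p x y
    rw [hermiteSumTwo_succ]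
    ring

/-- The key algebraic fact: the iterated sums form a ladder for the step operator. In the absence of
a fourth cumulant it already solves the recursion, with `p = n + 2`. -/
theorem corrStep_hermiteSumTwo (p : ℕ) :
    CorrStep (hermiteSumTwo p) (fun x y => ((p : ℝ) - 1) * hermiteSumTwo (p + 1) x y) := by
  induction p with
  | zero =>
    convert CorrStep.zero using 1 <;> ext x y <;> simp
  | succ p ih =>
    convert ih.add (corrStep_hermiteSum p) using 1
    · ext x y; simp [hermiteSumTwo_succ]
    · ext x y
      simp only [Pi.add_apply, hermiteSumTwo_succ, hermiteSum_succ]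
      push_cast
      ring

/-- The normalized second-order correlation function `f_n / n!`, as a function of
`a = (b - 3) / 2`. -/
def corrPoly (a : ℝ) (n : ℕ) (x y : ℝ) : ℝ :=
  ∑ k ∈ Finset.range (n + 1), a ^ k / k.factorial * hermiteSumTwo (n + 2 - 2 * k) x y

/-- Once `k > n` the truncated index `n + 2 - 2 * k` is `0` or `1`, and the iterated sum vanishes at
both. -/
theorem corrPoly_eq_sum (a : ℝ) {n M : ℕ} (h : n + 1 ≤ M) (x y : ℝ) :
    corrPoly a n x y
      = ∑ k ∈ Finset.range M, a ^ k / k.factorial * hermiteSumTwo (n + 2 - 2 * k) x y := by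
  refine Finset.sum_subset (Finset.range_subset_range.2 h) fun k _ hk => ?_
  have hk' : n + 1 ≤ k := by simpa using hk
  obtain h0 | h0 : n + 2 - 2 * k = 0 ∨ n + 2 - 2 * k = 1 := by omega
  all_goals simp [h0]

theorem corrPoly_zero (a x y : ℝ) : corrPoly a 0 x y = 1 := by
  simp [corrPoly, hermiteSumTwo_succ, hermiteSum_succ, hermiteProd]

/-- The ladder factor of the `k`-th term is `(n + 1) - 2 k`. The part `n + 1` builds the next
polynomial; in the part `2 k`, the identity `k · a^k / k! = a · a^(k-1) / (k-1)!` shifts the sum by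
one. The subtracted sum is the polynomial of dimension `n - 1`, which the fourth-cumulant term of
the probabilistic recursion cancels. -/
theorem corrStep_corrPoly (a : ℝ) (n : ℕ) :
    CorrStep (corrPoly a n)
      (fun x y => (n + 1) * corrPoly a (n + 1) x y
        - 2 * a * ∑ k ∈ Finset.range (n + 1),
            a ^ k / k.factorial * hermiteSumTwo (n + 1 - 2 * k) x y) := by
  have h := CorrStep.sum (Finset.range (n + 2)) (fun k _ =>
    (corrStep_hermiteSumTwo (n + 2 - 2 * k)).const_smul (a ^ k / k.factorial))
  convert h using 1
  · ext x y
    rw [corrPoly_eq_sum a (Nat.le_succ (n + 1))]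
    simp
  · ext x y
    simp only [Finset.sum_apply, Pi.smul_apply, smul_eq_mul]
    -- When the subtraction truncates, the two indices are `1` and `0`, and both sides are zero.
    have key : ∀ k, (((n + 2 - 2 * k : ℕ) : ℝ) - 1) * hermiteSumTwo (n + 2 - 2 * k + 1) x y
        = ((n : ℝ) + 1) * hermiteSumTwo (n + 1 + 2 - 2 * k) x y
          - 2 * (k : ℝ) * hermiteSumTwo (n + 1 + 2 - 2 * k) x y := by
      intro k
      rcases le_or_gt (2 * k) (n + 2) with hk | hk
      · rw [Nat.cast_sub hk, show n + 2 - 2 * k + 1 = n + 1 + 2 - 2 * k by omega]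
        push_cast
        ring
      · rw [show n + 2 - 2 * k = 0 by omega, show n + 1 + 2 - 2 * k = 0 by omega]
        simp
    simp only [key, mul_sub, Finset.sum_sub_distrib]
    congr 1
    · rw [corrPoly, Finset.mul_sum]
      exact Finset.sum_congr rfl fun k _ => by ring
    · symm
      rw [Finset.sum_range_succ', Finset.mul_sum]
      simp only [Nat.cast_zero, mul_zero, zero_mul, add_zero]
      refine Finset.sum_congr rfl fun k _ => ?_
      rw [show n + 1 + 2 - 2 * (k + 1) = n + 1 - 2 * k by omega, Nat.factorial_succ, pow_succ]
      have : (k.factorial : ℝ) ≠ 0 := by exact_mod_cast k.factorial_ne_zero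
      have : (k : ℝ) + 1 ≠ 0 := by positivity
      push_cast
      field_simp

end CorrStep

/-! ### Determinants -/

section Determinants

variable {n : ℕ}

/-- Cauchy's expansion of a bordered determinant. -/
theorem det_bordered {R : Type*} [CommRing R] (M : Matrix (Fin (n + 1)) (Fin (n + 1)) R) :
    M.det = M 0 0 * (M.submatrix Fin.succ Fin.succ).det
      - ∑ i, ∑ j, M 0 (Fin.succ i) * M (Fin.succ j) 0
          * (M.submatrix Fin.succ Fin.succ).adjugate i j := by
  rw [Matrix.det_succ_row_zero, Fin.sum_univ_succ]
  simp only [Fin.val_zero, pow_zero, one_mul, Fin.succAbove_zero]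
  rw [sub_eq_add_neg, ← Finset.sum_neg_distrib]
  congr 1
  refine Finset.sum_congr rfl fun i _ => ?_
  cases n with
  | zero => exact i.elim0
  | succ n =>
    rw [Matrix.det_succ_column_zero, Finset.mul_sum, ← Finset.sum_neg_distrib]
    refine Finset.sum_congr rfl fun j _ => ?_
    rw [Matrix.adjugate_fin_succ_eq_det_submatrix]
    simp only [Matrix.submatrix_apply, Matrix.submatrix_submatrix, Fin.val_succ]
    have : Matrix.submatrix M (Fin.succ ∘ j.succAbove) (i.succ.succAbove ∘ Fin.succ)
        = Matrix.submatrix M (Fin.succ ∘ j.succAbove) (Fin.succ ∘ i.succAbove) := by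
      ext a b; simp
    rw [this, Fin.succ_succAbove_zero]
    ring

theorem hasDerivAt_det_sub_smul_one (X : Matrix (Fin n) (Fin n) ℝ) (t : ℝ) :
    HasDerivAt (fun t : ℝ => (X - t • (1 : Matrix (Fin n) (Fin n) ℝ)).det)
      (-(X - t • (1 : Matrix (Fin n) (Fin n) ℝ)).adjugate.trace) t := by
  have hentry : ∀ i j, HasDerivAt (fun t : ℝ => (X - t • (1 : Matrix (Fin n) (Fin n) ℝ)) i j)
      (-(1 : Matrix (Fin n) (Fin n) ℝ) i j) t := by
    intro i j
    simp only [Matrix.sub_apply, Matrix.smul_apply, smul_eq_mul]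
    simpa using ((hasDerivAt_id t).mul_const ((1 : Matrix (Fin n) (Fin n) ℝ) i j)).const_sub (X i j)
  -- Permutation expansion with one factor per row, so that differentiating the `i`-th factor
  -- amounts to the row replacement that defines the adjugate.
  have hdet : ∀ M : Matrix (Fin n) (Fin n) ℝ,
      M.det = ∑ σ : Equiv.Perm (Fin n), ((Equiv.Perm.sign σ : ℤ) : ℝ) * ∏ i, M i (σ i) := by
    intro M
    rw [← Matrix.det_transpose, Matrix.det_apply']
    rfl
  simp only [hdet]
  refine (HasDerivAt.fun_sum fun σ _ => (HasDerivAt.fun_finsetProd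
    fun i _ => hentry i (σ i)).const_mul _).congr_deriv ?_
  simp only [Matrix.trace, Matrix.diag, Matrix.adjugate_apply, hdet]
  rw [Finset.sum_comm, ← Finset.sum_neg_distrib]
  refine Finset.sum_congr rfl fun σ _ => ?_
  rw [← Finset.mul_sum, ← mul_neg, ← Finset.sum_neg_distrib]
  congr 1
  refine Finset.sum_congr rfl fun i _ => ?_
  rw [← Finset.mul_prod_erase _ _ (Finset.mem_univ i), Matrix.updateRow_self, smul_eq_mul, mul_neg,
    mul_comm]
  congr 2
  · simp [Matrix.one_apply, Pi.single_apply, eq_comm]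
  · refine Finset.prod_congr rfl fun j hj => ?_
    rw [Matrix.updateRow_ne (Finset.ne_of_mem_erase hj)]

/-- A resolvent identity for adjugates, valid without invertibility: expand `adj A (A - B) adj B`
with `A - B = (t - s) 1`. It exhibits the trace of the product of adjugates as a divided difference
of derivatives of the determinants. -/
theorem sub_mul_trace_adjugate_mul (X : Matrix (Fin n) (Fin n) ℝ) (s t : ℝ) :
    (t - s) * ((X - s • (1 : Matrix (Fin n) (Fin n) ℝ)).adjugate
        * (X - t • (1 : Matrix (Fin n) (Fin n) ℝ)).adjugate).trace
      = (X - s • (1 : Matrix (Fin n) (Fin n) ℝ)).det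
          * (X - t • (1 : Matrix (Fin n) (Fin n) ℝ)).adjugate.trace
        - (X - t • (1 : Matrix (Fin n) (Fin n) ℝ)).det
          * (X - s • (1 : Matrix (Fin n) (Fin n) ℝ)).adjugate.trace := by
  set A := X - s • (1 : Matrix (Fin n) (Fin n) ℝ)
  set B := X - t • (1 : Matrix (Fin n) (Fin n) ℝ)
  have hAB : (t - s) • (1 : Matrix (Fin n) (Fin n) ℝ) = A - B := by
    simp only [A, B]; rw [sub_smul]; abel
  have h : (t - s) • (A.adjugate * B.adjugate) = A.det • B.adjugate - B.det • A.adjugate := by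
    calc (t - s) • (A.adjugate * B.adjugate)
        = A.adjugate * ((t - s) • (1 : Matrix (Fin n) (Fin n) ℝ)) * B.adjugate := by
          simp
      _ = (A.adjugate * A) * B.adjugate - A.adjugate * (B * B.adjugate) := by
          rw [hAB]; noncomm_ring
      _ = _ := by rw [Matrix.adjugate_mul, Matrix.mul_adjugate]; simp
  have := congrArg Matrix.trace h
  simpa [Matrix.trace_sub, Matrix.trace_smul] using this

/-- The position on or above the diagonal that carries the `(i, j)` entry of a symmetric matrix. -/
def upperIndex (i j : Fin n) : {p : Fin n × Fin n // p.1 ≤ p.2} := ⟨(min i j, max i j), min_le_max⟩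

/-- A position `{k, l}` can only be hit by the rows `k` and `l`, hence at most twice. Minors are
therefore at most quadratic in each entry, and a product of two minors needs only fourth moments. -/
theorem prod_upperIndex_perm_le (w : {p : Fin n × Fin n // p.1 ≤ p.2} → ℝ) (hw : ∀ p, 1 ≤ w p)
    (σ : Equiv.Perm (Fin n)) : ∏ i, w (upperIndex i (σ i)) ≤ ∏ p, w p ^ 2 := by
  classical
  rw [← Finset.prod_fiberwise Finset.univ (fun i => upperIndex i (σ i))]
  refine Finset.prod_le_prod (fun p _ => Finset.prod_nonneg fun i _ =>
    zero_le_one.trans (hw _)) fun p _ => ?_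
  rw [Finset.prod_congr rfl (g := fun _ => w p) fun i hi => by rw [(Finset.mem_filter.1 hi).2],
    Finset.prod_const]
  refine pow_le_pow_right₀ (hw p) ?_
  refine (Finset.card_le_card (t := {p.1.1, p.1.2}) fun i hi => ?_).trans Finset.card_le_two
  have hi' := (Finset.mem_filter.1 hi).2
  subst hi'
  simp only [upperIndex, Finset.mem_insert, Finset.mem_singleton]
  rcases le_total i (σ i) with h | h
  · left; exact (min_eq_left h).symm
  · right; exact (max_eq_left h).symm

theorem abs_det_le_of_entry_le (M : Matrix (Fin n) (Fin n) ℝ)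
    (w : {p : Fin n × Fin n // p.1 ≤ p.2} → ℝ) (hw : ∀ p, 1 ≤ w p) (C : ℝ) (hC : 0 ≤ C)
    (hM : ∀ i j, |M i j| ≤ C * w (upperIndex i j)) :
    |M.det| ≤ n.factorial * C ^ n * ∏ p, w p ^ 2 := by
  rw [← Matrix.det_transpose, Matrix.det_apply']
  refine (Finset.abs_sum_le_sum_abs _ _).trans ?_
  have : ∀ σ : Equiv.Perm (Fin n), |((Equiv.Perm.sign σ : ℤ) : ℝ) * ∏ i, M.transpose (σ i) i|
      ≤ C ^ n * ∏ p, w p ^ 2 := by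
    intro σ
    rw [abs_mul, show |((Equiv.Perm.sign σ : ℤ) : ℝ)| = 1 by
      rcases Int.units_eq_one_or (Equiv.Perm.sign σ) with h | h <;> simp [h], one_mul,
      Finset.abs_prod]
    calc ∏ i, |M.transpose (σ i) i| ≤ ∏ i, C * w (upperIndex i (σ i)) :=
          Finset.prod_le_prod (fun _ _ => abs_nonneg _) fun i _ => hM i (σ i)
      _ = C ^ n * ∏ i, w (upperIndex i (σ i)) := by
          rw [Finset.prod_mul_distrib]; simp
      _ ≤ _ := by
          gcongr
          exact prod_upperIndex_perm_le w hw σ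
  refine (Finset.sum_le_card_nsmul _ _ _ fun σ _ => this σ).trans ?_
  rw [Finset.card_univ, Fintype.card_perm, Fintype.card_fin, nsmul_eq_mul, mul_assoc]

theorem isSymm_symmetricMatrix (ξ : Fin n → Fin n → ℝ) : (symmetricMatrix ξ).IsSymm := by
  ext i j
  simp only [symmetricMatrix, Matrix.transpose_apply, Matrix.of_apply]
  rcases lt_trichotomy i j with h | h | h
  · simp [h, h.not_gt, h.ne']
  · subst h; simp
  · simp [h, h.not_gt, h.ne']

theorem symmetricMatrix_submatrix {m : ℕ} (ξ : Fin n → Fin n → ℝ) {e : Fin m → Fin n}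
    (he : StrictMono e) :
    (symmetricMatrix ξ).submatrix e e = symmetricMatrix (fun i j => ξ (e i) (e j)) := by
  ext i j
  simp [symmetricMatrix, he.lt_iff_lt, he.injective.eq_iff]

theorem symmetricMatrix_sub_smul_submatrix {m : ℕ} (ξ : Fin n → Fin n → ℝ) {e : Fin m → Fin n}
    (he : StrictMono e) (t : ℝ) :
    (symmetricMatrix ξ - t • (1 : Matrix (Fin n) (Fin n) ℝ)).submatrix e e
      = symmetricMatrix (fun i j => ξ (e i) (e j)) - t • (1 : Matrix (Fin m) (Fin m) ℝ) := by
  rw [← symmetricMatrix_submatrix ξ he, Matrix.submatrix_sub, Matrix.submatrix_smul]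
  simp [Matrix.submatrix_one _ he.injective]

theorem abs_symmetricMatrix_sub_smul_le (ξ : Fin n → Fin n → ℝ) (t : ℝ) (i j : Fin n) :
    |(symmetricMatrix ξ - t • (1 : Matrix (Fin n) (Fin n) ℝ)) i j|
      ≤ (2 + |t|) * (1 + |ξ (upperIndex i j).1.1 (upperIndex i j).1.2|) := by
  have h2 : Real.sqrt 2 ≤ 2 := by
    rw [Real.sqrt_le_left (by norm_num)]; norm_num
  have ht := abs_nonneg t
  rcases lt_trichotomy i j with h | h | h
  · simp only [symmetricMatrix, upperIndex, Matrix.sub_apply, Matrix.of_apply, h, if_true,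
      Matrix.smul_apply, Matrix.one_apply, h.ne, if_false, smul_zero, sub_zero, min_eq_left h.le,
      max_eq_right h.le]
    nlinarith [abs_nonneg (ξ i j)]
  · subst h
    simp only [symmetricMatrix, upperIndex, Matrix.sub_apply, Matrix.of_apply, lt_irrefl, if_false,
      if_true, Matrix.smul_apply, Matrix.one_apply, smul_eq_mul, mul_one, min_self, max_self]
    refine (abs_sub _ _).trans ?_
    rw [abs_mul, abs_of_nonneg (Real.sqrt_nonneg 2)]
    nlinarith [abs_nonneg (ξ i i), mul_nonneg ht (abs_nonneg (ξ i i))]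
  · simp only [symmetricMatrix, upperIndex, Matrix.sub_apply, Matrix.of_apply, h.not_gt, if_false,
      Matrix.smul_apply, Matrix.one_apply, h.ne', smul_zero, sub_zero, min_eq_right h.le,
      max_eq_left h.le]
    nlinarith [abs_nonneg (ξ j i)]

theorem abs_det_symmetricMatrix_sub_smul_le (ξ : Fin n → Fin n → ℝ) (t : ℝ) :
    |(symmetricMatrix ξ - t • (1 : Matrix (Fin n) (Fin n) ℝ)).det|
      ≤ n.factorial * (2 + |t|) ^ n
        * ∏ p : {p : Fin n × Fin n // p.1 ≤ p.2}, (1 + |ξ p.1.1 p.1.2|) ^ 2 :=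
  abs_det_le_of_entry_le _ (fun p => 1 + |ξ p.1.1 p.1.2|)
    (fun p => le_add_of_nonneg_right (abs_nonneg _)) _ (by positivity)
    (abs_symmetricMatrix_sub_smul_le ξ t)

theorem abs_adjugate_symmetricMatrix_sub_smul_le (ξ : Fin n → Fin n → ℝ) (t : ℝ) (i j : Fin n) :
    |(symmetricMatrix ξ - t • (1 : Matrix (Fin n) (Fin n) ℝ)).adjugate i j|
      ≤ n.factorial * (2 + |t|) ^ n
        * ∏ p : {p : Fin n × Fin n // p.1 ≤ p.2}, (1 + |ξ p.1.1 p.1.2|) ^ 2 := by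
  rw [Matrix.adjugate_apply]
  refine abs_det_le_of_entry_le _ (fun p => 1 + |ξ p.1.1 p.1.2|)
    (fun p => le_add_of_nonneg_right (abs_nonneg _)) _ (by positivity) fun k l => ?_
  by_cases hk : k = j
  · subst hk
    rw [Matrix.updateRow_self]
    have h1 : |(Pi.single i 1 : Fin n → ℝ) l| ≤ 1 := by
      by_cases hl : l = i
      · subst hl; simp
      · simp [hl]
    have := abs_nonneg (ξ (upperIndex k l).1.1 (upperIndex k l).1.2)
    nlinarith [abs_nonneg t, mul_nonneg (abs_nonneg t) this]
  · rw [Matrix.updateRow_ne hk]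
    exact abs_symmetricMatrix_sub_smul_le ξ t k l

theorem abs_trace_adjugate_symmetricMatrix_sub_smul_le (ξ : Fin n → Fin n → ℝ) (t : ℝ) :
    |(symmetricMatrix ξ - t • (1 : Matrix (Fin n) (Fin n) ℝ)).adjugate.trace|
      ≤ n * (n.factorial * (2 + |t|) ^ n)
        * ∏ p : {p : Fin n × Fin n // p.1 ≤ p.2}, (1 + |ξ p.1.1 p.1.2|) ^ 2 := by
  refine (Finset.abs_sum_le_sum_abs _ _).trans ((Finset.sum_le_card_nsmul _ _ _ fun i _ =>
    abs_adjugate_symmetricMatrix_sub_smul_le ξ t i i).trans ?_)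
  simp [mul_assoc]

end Determinants

/-! ### Independence and moments -/

section Independence

variable {Ω : Type*}

/-- The σ-algebra generated by the variables `X i`, `i ∈ S`. -/
@[reducible] def sigmaOf {ι : Type*} (X : ι → Ω → ℝ) (S : Set ι) : MeasurableSpace Ω :=
  ⨆ i ∈ S, (inferInstance : MeasurableSpace ℝ).comap (X i)

theorem measurable_sigmaOf {ι : Type*} (X : ι → Ω → ℝ) {S : Set ι} {i : ι} (hi : i ∈ S) :
    Measurable[sigmaOf X S] (X i) :=
  (comap_measurable (X i)).mono
    (le_iSup₂ (f := fun i (_ : i ∈ S) => (inferInstance : MeasurableSpace ℝ).comap (X i)) i hi)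
    le_rfl

variable [MeasurableSpace Ω] {P : Measure Ω} {Q : Measure ℝ}

theorem indepFun_of_measurable_sigmaOf {ι : Type*} {X : ι → Ω → ℝ} (hX : iIndepFun X P)
    (hm : ∀ i, Measurable (X i)) {S T : Set ι} (hST : Disjoint S T) {f g : Ω → ℝ}
    (hf : Measurable[sigmaOf X S] f) (hg : Measurable[sigmaOf X T] g) : IndepFun f g P := by
  rw [IndepFun_iff_Indep]
  have h := indep_iSup_of_disjoint (fun i => (hm i).comap_le) ((iIndepFun_iff_iIndep _ _ _).1 hX)
    hST
  exact indep_of_indep_of_le h hf.comap_le hg.comap_le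

theorem integrable_one_add_abs_pow_four [IsProbabilityMeasure Q]
    (hfourth : Integrable (fun x : ℝ => x ^ 4) Q) : Integrable (fun x : ℝ => (1 + |x|) ^ 4) Q := by
  -- Convexity: `(1 + u) ^ 4 ≤ 8 (1 + u ^ 4)` for `u ≥ 0`.
  refine (((integrable_const 1).add hfourth).const_mul 8).mono'
    (by fun_prop) (ae_of_all _ fun x => ?_)
  have h : x ^ 4 = |x| ^ 4 := by rw [← abs_pow, abs_of_nonneg (by positivity)]
  rw [Real.norm_of_nonneg (by positivity)]
  simp only [Pi.add_apply, h]
  nlinarith [sq_nonneg (|x| - 1), sq_nonneg (|x| ^ 2 - 1), sq_nonneg (|x| + 1),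
    mul_nonneg (sq_nonneg (|x| - 1)) (sq_nonneg (|x| + 1)), abs_nonneg x,
    mul_nonneg (sq_nonneg (|x| - 1)) (sq_nonneg (|x| - 1))]

theorem integral_mul_eq_zero_of_indepFun {X Y : Ω → ℝ} (h : IndepFun X Y P) (hX : Measurable X)
    (hY : Measurable Y) (h0 : ∫ ω, X ω ∂P = 0) : ∫ ω, X ω * Y ω ∂P = 0 := by
  rw [h.integral_fun_mul_eq_mul_integral hX.aestronglyMeasurable hY.aestronglyMeasurable, h0,
    zero_mul]

theorem hasLaw_integral_pow {X : Ω → ℝ} (h : HasLaw X Q P) (k : ℕ) :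
    ∫ ω, X ω ^ k ∂P = ∫ x, x ^ k ∂Q :=
  h.integral_comp (f := fun x => x ^ k) (by fun_prop)

theorem integral_mul_of_iIndepFun {ι : Type*} [DecidableEq ι] {v : ι → Ω → ℝ}
    (hv : iIndepFun v P) (hm : ∀ i, Measurable (v i)) (hlaw : ∀ i, HasLaw (v i) Q P)
    (hmean : ∫ x, x ∂Q = 0) (hvar : ∫ x, x ^ 2 ∂Q = 1) (i j : ι) :
    ∫ ω, v i ω * v j ω ∂P = if i = j then 1 else 0 := by
  split_ifs with h
  · subst h
    rw [← hvar, ← hasLaw_integral_pow (hlaw i) 2]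
    simp [sq]
  · refine integral_mul_eq_zero_of_indepFun (hv.indepFun h) (hm i) (hm j) ?_
    simpa [hmean] using hasLaw_integral_pow (hlaw i) 1

/-- The three pairings of Wick's formula plus the fourth cumulant. An index different from the other
three gives zero; two distinct pairs give `1`; when all indices agree the pairings give `3`, and the
last term corrects this to the fourth moment. -/
theorem integral_mul_four_of_iIndepFun {ι : Type*} [DecidableEq ι] {v : ι → Ω → ℝ}
    (hv : iIndepFun v P) (hm : ∀ i, Measurable (v i)) (hlaw : ∀ i, HasLaw (v i) Q P)
    (hmean : ∫ x, x ∂Q = 0) (hvar : ∫ x, x ^ 2 ∂Q = 1) (i j k l : ι) :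
    ∫ ω, (v i ω * v j ω) * (v k ω * v l ω) ∂P
      = (if i = j then if k = l then 1 else 0 else 0) + (if i = k then if j = l then 1 else 0 else 0)
        + (if i = l then if j = k then 1 else 0 else 0)
        + ((∫ x, x ^ 4 ∂Q) - 3) * (if i = j then if i = k then if i = l then 1 else 0 else 0 else 0)
      := by
  have hzero : ∀ i j k l, i ≠ j → i ≠ k → i ≠ l → ∫ ω, v i ω * (v j ω * (v k ω * v l ω)) ∂P = 0 := by
    intro i j k l hij hik hil
    have hd : Disjoint ({i} : Set ι) ({j, k, l} : Set ι) := by simp [hij, hik, hil]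
    refine integral_mul_eq_zero_of_indepFun (indepFun_of_measurable_sigmaOf hv hm hd
      (measurable_sigmaOf v (Set.mem_singleton i))
      ((measurable_sigmaOf v (by simp)).mul ((measurable_sigmaOf v (by simp)).mul
        (measurable_sigmaOf v (by simp))))) (hm i) ((hm j).mul ((hm k).mul (hm l))) ?_
    simpa [hmean] using hasLaw_integral_pow (hlaw i) 1
  have hpair : ∀ i k, i ≠ k → ∫ ω, v i ω ^ 2 * v k ω ^ 2 ∂P = 1 := by
    intro i k hik
    have hd : Disjoint ({i} : Set ι) ({k} : Set ι) := by simp [hik]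
    have := (indepFun_of_measurable_sigmaOf hv hm hd
      ((measurable_sigmaOf v (Set.mem_singleton i)).pow_const 2)
      ((measurable_sigmaOf v (Set.mem_singleton k)).pow_const 2)).integral_fun_mul_eq_mul_integral
      ((hm i).pow_const 2).aestronglyMeasurable ((hm k).pow_const 2).aestronglyMeasurable
    rw [this, hasLaw_integral_pow (hlaw i) 2, hasLaw_integral_pow (hlaw k) 2, hvar, one_mul]
  by_cases hij : i = j
  · subst hij
    by_cases hik : i = k
    · subst hik
      by_cases hil : i = l
      · subst hil
        rw [show (fun ω => v i ω * v i ω * (v i ω * v i ω)) = fun ω => v i ω ^ 4 by ext; ring,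
          hasLaw_integral_pow (hlaw i) 4]
        simp
        ring
      · have := hzero l i i i (Ne.symm hil) (Ne.symm hil) (Ne.symm hil)
        simp only [hil, if_true, if_false]
        rw [← this.trans (by simp : (0 : ℝ) = 0 + 0 + 0 + ((∫ x, x ^ 4 ∂Q) - 3) * 0)]
        congr 1; ext; ring
    · by_cases hkl : k = l
      · subst hkl
        rw [show (fun ω => v i ω * v i ω * (v k ω * v k ω)) = fun ω => v i ω ^ 2 * v k ω ^ 2 by
          ext; ring, hpair i k hik]
        simp [hik]
      · have := hzero k i i l (Ne.symm hik) (Ne.symm hik) hkl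
        rw [show (fun ω => v i ω * v i ω * (v k ω * v l ω))
          = fun ω => v k ω * (v i ω * (v i ω * v l ω)) by ext; ring, this]
        simp [hik, hkl]
  · by_cases hik : i = k
    · subst hik
      by_cases hjl : j = l
      · subst hjl
        rw [show (fun ω => v i ω * v j ω * (v i ω * v j ω)) = fun ω => v i ω ^ 2 * v j ω ^ 2 by
          ext; ring, hpair i j hij]
        simp [hij]
      · have := hzero j i i l (Ne.symm hij) (Ne.symm hij) hjl
        rw [show (fun ω => v i ω * v j ω * (v i ω * v l ω))
          = fun ω => v j ω * (v i ω * (v i ω * v l ω)) by ext; ring, this]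
        simp [hij, hjl, Ne.symm hij]
    · by_cases hil : i = l
      · subst hil
        by_cases hjk : j = k
        · subst hjk
          rw [show (fun ω => v i ω * v j ω * (v j ω * v i ω)) = fun ω => v i ω ^ 2 * v j ω ^ 2 by
            ext; ring, hpair i j hij]
          simp [hij]
        · have := hzero j i k i (Ne.symm hij) hjk (Ne.symm hij)
          rw [show (fun ω => v i ω * v j ω * (v k ω * v i ω))
            = fun ω => v j ω * (v i ω * (v k ω * v i ω)) by ext; ring, this]
          simp [hij, hik, hjk]
      · have := hzero i j k l hij hik hil
        rw [show (fun ω => v i ω * v j ω * (v k ω * v l ω))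
          = fun ω => v i ω * (v j ω * (v k ω * v l ω)) by ext; ring, this]
        simp [hij, hik, hil]

end Independence

/-! ### Integrability and differentiation of the correlation function -/

section Wigner

variable {Ω : Type*} {n : ℕ} {ξ : Fin n → Fin n → Ω → ℝ}

/-- A random variable dominating, up to constants, all the minors of the matrix built from `ξ`. -/
def minorBound (ξ : Fin n → Fin n → Ω → ℝ) (ω : Ω) : ℝ :=
  ∏ p : {p : Fin n × Fin n // p.1 ≤ p.2}, (1 + |ξ p.1.1 p.1.2 ω|) ^ 2

/-- The adjugate of `X - t`, as a random matrix. -/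
def wignerAdj (ξ : Fin n → Fin n → Ω → ℝ) (t : ℝ) (ω : Ω) : Matrix (Fin n) (Fin n) ℝ :=
  (symmetricMatrix (fun i j => ξ i j ω) - t • (1 : Matrix (Fin n) (Fin n) ℝ)).adjugate

theorem abs_wignerCharDet_le (t : ℝ) (ω : Ω) :
    |wignerCharDet ξ t ω| ≤ n.factorial * (2 + |t|) ^ n * minorBound ξ ω :=
  abs_det_symmetricMatrix_sub_smul_le _ t

theorem abs_wignerAdj_le (t : ℝ) (ω : Ω) (i j : Fin n) :
    |wignerAdj ξ t ω i j| ≤ n.factorial * (2 + |t|) ^ n * minorBound ξ ω :=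
  abs_adjugate_symmetricMatrix_sub_smul_le _ t i j

theorem abs_trace_wignerAdj_le (t : ℝ) (ω : Ω) :
    |(wignerAdj ξ t ω).trace| ≤ n * (n.factorial * (2 + |t|) ^ n) * minorBound ξ ω :=
  abs_trace_adjugate_symmetricMatrix_sub_smul_le _ t

theorem measurable_det {m : MeasurableSpace Ω} {M : Ω → Matrix (Fin n) (Fin n) ℝ}
    (hM : ∀ i j, Measurable[m] fun ω => M ω i j) : Measurable[m] fun ω => (M ω).det := by
  simp only [Matrix.det_apply']
  exact Finset.measurable_fun_sum _ fun σ _ =>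
    (Finset.measurable_fun_prod _ fun i _ => hM (σ i) i).const_mul _

theorem measurable_symmetricMatrix_sub_smul {m : MeasurableSpace Ω}
    (hξ : ∀ i j, i ≤ j → Measurable[m] (ξ i j)) (t : ℝ) (i j : Fin n) :
    Measurable[m] fun ω =>
      (symmetricMatrix (fun i j => ξ i j ω) - t • (1 : Matrix (Fin n) (Fin n) ℝ)) i j := by
  simp only [symmetricMatrix, Matrix.sub_apply, Matrix.of_apply]
  refine Measurable.sub_const ?_ _
  rcases lt_trichotomy i j with h | h | h
  · simpa [h] using hξ i j h.le
  · subst h; simpa using (hξ i i le_rfl).const_mul _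
  · simpa [h.not_gt, h.ne'] using hξ j i h.le

theorem measurable_wignerCharDet {m : MeasurableSpace Ω}
    (hξ : ∀ i j, i ≤ j → Measurable[m] (ξ i j)) (t : ℝ) : Measurable[m] (wignerCharDet ξ t) :=
  measurable_det (measurable_symmetricMatrix_sub_smul hξ t)

theorem measurable_wignerAdj {m : MeasurableSpace Ω}
    (hξ : ∀ i j, i ≤ j → Measurable[m] (ξ i j)) (t : ℝ) (i j : Fin n) :
    Measurable[m] fun ω => wignerAdj ξ t ω i j := by
  simp only [wignerAdj, Matrix.adjugate_apply]
  refine measurable_det fun k l => ?_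
  by_cases hk : k = j
  · subst hk
    simp only [Matrix.updateRow_self]
    exact measurable_const
  · simp only [Matrix.updateRow_ne hk]
    exact measurable_symmetricMatrix_sub_smul hξ t k l

theorem measurable_trace_wignerAdj {m : MeasurableSpace Ω}
    (hξ : ∀ i j, i ≤ j → Measurable[m] (ξ i j)) (t : ℝ) :
    Measurable[m] fun ω => (wignerAdj ξ t ω).trace :=
  Finset.measurable_fun_sum _ fun i _ => measurable_wignerAdj hξ t i i

theorem minorBound_nonneg (ω : Ω) : 0 ≤ minorBound ξ ω :=
  Finset.prod_nonneg fun _ _ => sq_nonneg _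

variable [MeasurableSpace Ω] {P : Measure Ω}

theorem corrFun_comm (μ ν : ℝ) : corrFun P ξ μ ν = corrFun P ξ ν μ := by
  simp only [corrFun, mul_comm]

variable {Q : Measure ℝ} [IsProbabilityMeasure Q]

theorem integrable_minorBound_mul_self (hfourth : Integrable (fun x : ℝ => x ^ 4) Q)
    (hξ : IsIIDUpperTriangle P Q ξ) :
    Integrable (fun ω => minorBound ξ ω * minorBound ξ ω) P := by
  have hlaw := iIndepFun.hasLaw_pi (fun p : {p : Fin n × Fin n // p.1 ≤ p.2} =>
    hξ.hasLaw p.1.1 p.1.2 p.2) hξ.indep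
  have hint : Integrable (fun x : {p : Fin n × Fin n // p.1 ≤ p.2} → ℝ => ∏ p, (1 + |x p|) ^ 4)
      (Measure.pi fun _ => Q) :=
    Integrable.fintype_prod (f := fun _ x => (1 + |x|) ^ 4)
      fun _ => integrable_one_add_abs_pow_four hfourth
  rw [← hlaw.map_eq] at hint
  have := hint.comp_aemeasurable hlaw.aemeasurable
  refine this.congr (ae_of_all _ fun ω => ?_)
  simp only [Function.comp, minorBound, ← Finset.prod_mul_distrib]
  exact Finset.prod_congr rfl fun p _ => by ring

theorem integrable_mul_of_abs_le_minorBound (hfourth : Integrable (fun x : ℝ => x ^ 4) Q)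
    (hξ : IsIIDUpperTriangle P Q ξ) {f g : Ω → ℝ} (hf : Measurable f) (hg : Measurable g)
    {C D : ℝ} (hC : ∀ ω, |f ω| ≤ C * minorBound ξ ω) (hD : ∀ ω, |g ω| ≤ D * minorBound ξ ω) :
    Integrable (fun ω => f ω * g ω) P := by
  refine ((integrable_minorBound_mul_self hfourth hξ).const_mul (C * D)).mono'
    (hf.mul hg).aestronglyMeasurable (ae_of_all _ fun ω => ?_)
  rw [Real.norm_eq_abs, abs_mul]
  calc |f ω| * |g ω| ≤ (C * minorBound ξ ω) * (D * minorBound ξ ω) :=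
        mul_le_mul (hC ω) (hD ω) (abs_nonneg _) ((abs_nonneg _).trans (hC ω))
    _ = _ := by ring

/-- Differentiation under the integral, dominated on a unit ball by a multiple of the integrable
square of `minorBound`. The general factor `g` allows a second use with `g` a trace of an adjugate,
for the mixed derivative. -/
theorem hasDerivAt_integral_mul_wignerCharDet (hfourth : Integrable (fun x : ℝ => x ^ 4) Q)
    (hξ : IsIIDUpperTriangle P Q ξ) (hm : ∀ i j, Measurable (ξ i j)) {g : Ω → ℝ}
    (hg : Measurable g) {C : ℝ} (hC : ∀ ω, |g ω| ≤ C * minorBound ξ ω) (t : ℝ) :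
    HasDerivAt (fun t => ∫ ω, g ω * wignerCharDet ξ t ω ∂P)
      (-∫ ω, g ω * (wignerAdj ξ t ω).trace ∂P) t := by
  rw [← integral_neg]
  have hm' : ∀ i j, i ≤ j → Measurable (ξ i j) := fun i j _ => hm i j
  refine (hasDerivAt_integral_of_dominated_loc_of_deriv_le
    (F := fun t ω => g ω * wignerCharDet ξ t ω)
    (F' := fun t ω => -(g ω * (wignerAdj ξ t ω).trace))
    (bound := fun ω => C * (n * (n.factorial * (2 + (|t| + 1)) ^ n))
      * (minorBound ξ ω * minorBound ξ ω))
    (Metric.ball_mem_nhds t one_pos)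
    (Eventually.of_forall fun s => (hg.mul (measurable_wignerCharDet hm' s)).aestronglyMeasurable)
    (integrable_mul_of_abs_le_minorBound hfourth hξ hg (measurable_wignerCharDet hm' t) hC
      (abs_wignerCharDet_le t))
    (hg.mul (measurable_trace_wignerAdj hm' t)).neg.aestronglyMeasurable
    (ae_of_all _ fun ω s hs => ?_) ((integrable_minorBound_mul_self hfourth hξ).const_mul _)
    (ae_of_all _ fun ω s _ => ?_)).2
  · have hs' : |s| ≤ |t| + 1 := by
      rw [Metric.mem_ball, Real.dist_eq] at hs
      have := abs_sub_abs_le_abs_sub s t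
      linarith
    rw [norm_neg, Real.norm_eq_abs, abs_mul]
    have hW := minorBound_nonneg (ξ := ξ) ω
    calc |g ω| * |(wignerAdj ξ s ω).trace|
        ≤ (C * minorBound ξ ω) * (n * (n.factorial * (2 + (|t| + 1)) ^ n) * minorBound ξ ω) := by
          refine mul_le_mul (hC ω) ((abs_trace_wignerAdj_le s ω).trans ?_) (abs_nonneg _)
            ((abs_nonneg _).trans (hC ω))
          gcongr
      _ = _ := by ring
  · simpa [wignerCharDet, wignerAdj] using
      (hasDerivAt_det_sub_smul_one (symmetricMatrix (fun i j => ξ i j ω)) s).const_mul (g ω)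

theorem hasDerivAt_corrFun_right (hfourth : Integrable (fun x : ℝ => x ^ 4) Q)
    (hξ : IsIIDUpperTriangle P Q ξ) (hm : ∀ i j, Measurable (ξ i j)) (μ ν : ℝ) :
    HasDerivAt (fun t => corrFun P ξ μ t)
      (-∫ ω, wignerCharDet ξ μ ω * (wignerAdj ξ ν ω).trace ∂P) ν :=
  hasDerivAt_integral_mul_wignerCharDet hfourth hξ hm
    (measurable_wignerCharDet (fun i j _ => hm i j) μ) (abs_wignerCharDet_le μ) ν

theorem hasDerivAt_corrFun_left (hfourth : Integrable (fun x : ℝ => x ^ 4) Q)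
    (hξ : IsIIDUpperTriangle P Q ξ) (hm : ∀ i j, Measurable (ξ i j)) (μ ν : ℝ) :
    HasDerivAt (fun s => corrFun P ξ s ν)
      (-∫ ω, wignerCharDet ξ ν ω * (wignerAdj ξ μ ω).trace ∂P) μ := by
  simp only [fun s => corrFun_comm (P := P) (ξ := ξ) s ν]
  exact hasDerivAt_corrFun_right hfourth hξ hm ν μ

theorem hasDerivAt_integral_det_mul_trace (hfourth : Integrable (fun x : ℝ => x ^ 4) Q)
    (hξ : IsIIDUpperTriangle P Q ξ) (hm : ∀ i j, Measurable (ξ i j)) (μ ν : ℝ) :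
    HasDerivAt (fun s => -∫ ω, wignerCharDet ξ s ω * (wignerAdj ξ ν ω).trace ∂P)
      (∫ ω, (wignerAdj ξ μ ω).trace * (wignerAdj ξ ν ω).trace ∂P) μ := by
  have := (hasDerivAt_integral_mul_wignerCharDet hfourth hξ hm
    (measurable_trace_wignerAdj (fun i j _ => hm i j) ν) (abs_trace_wignerAdj_le ν) μ).fun_neg
  rw [neg_neg] at this
  simpa only [mul_comm] using this

theorem sub_mul_integral_trace_wignerAdj_mul (hfourth : Integrable (fun x : ℝ => x ^ 4) Q)
    (hξ : IsIIDUpperTriangle P Q ξ) (hm : ∀ i j, Measurable (ξ i j)) (μ ν : ℝ) :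
    (ν - μ) * ∫ ω, (wignerAdj ξ μ ω * wignerAdj ξ ν ω).trace ∂P
      = (∫ ω, wignerCharDet ξ μ ω * (wignerAdj ξ ν ω).trace ∂P)
        - ∫ ω, wignerCharDet ξ ν ω * (wignerAdj ξ μ ω).trace ∂P := by
  have hm' : ∀ i j, i ≤ j → Measurable (ξ i j) := fun i j _ => hm i j
  rw [← integral_const_mul, ← integral_sub]
  · exact integral_congr_ae (ae_of_all _ fun ω => sub_mul_trace_adjugate_mul _ μ ν)
  · exact integrable_mul_of_abs_le_minorBound hfourth hξ (measurable_wignerCharDet hm' μ)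
      (measurable_trace_wignerAdj hm' ν) (abs_wignerCharDet_le μ) (abs_trace_wignerAdj_le ν)
  · exact integrable_mul_of_abs_le_minorBound hfourth hξ (measurable_wignerCharDet hm' ν)
      (measurable_trace_wignerAdj hm' μ) (abs_wignerCharDet_le ν) (abs_trace_wignerAdj_le μ)

end Wigner

/-! ### The recursion for the correlation function -/

section Recursion

theorem sum_ite_of_const {ι : Type*} [Fintype ι] (p : Prop) [Decidable p] (f : ι → ℝ) :
    ∑ i, (if p then f i else 0) = if p then ∑ i, f i else 0 := by
  split_ifs <;> simp

theorem IsIIDUpperTriangle.comp_strictMono {Ω : Type*} [MeasurableSpace Ω] {P : Measure Ω}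
    {Q : Measure ℝ} {n m : ℕ} {ξ : Fin n → Fin n → Ω → ℝ} (hξ : IsIIDUpperTriangle P Q ξ)
    {e : Fin m → Fin n} (he : StrictMono e) :
    IsIIDUpperTriangle P Q (fun i j => ξ (e i) (e j)) where
  hasLaw i j hij := hξ.hasLaw _ _ (he.monotone hij)
  indep := by
    refine hξ.indep.precomp (g := fun p : {p : Fin m × Fin m // p.1 ≤ p.2} =>
      (⟨(e p.1.1, e p.1.2), he.monotone p.2⟩ : {p : Fin n × Fin n // p.1 ≤ p.2}))
      fun p q hpq => ?_
    simp only [Subtype.mk.injEq, Prod.mk.injEq, he.injective.eq_iff] at hpq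
    exact Subtype.ext (Prod.ext hpq.1 hpq.2)

variable {Ω : Type*} {n : ℕ}

/-- The factors depending on the first row in the bordered expansion of `det (X - t)`. -/
def rowFactor (ξ : Fin (n + 1) → Fin (n + 1) → Ω → ℝ) (t : ℝ) :
    Option (Fin n × Fin n) → Ω → ℝ
  | none => fun ω => Real.sqrt 2 * ξ 0 0 ω - t
  | some p => fun ω => -(ξ 0 p.1.succ ω * ξ 0 p.2.succ ω)

/-- The factors depending on the remaining rows in the bordered expansion of `det (X - t)`. -/
def minorFactor (η : Fin n → Fin n → Ω → ℝ) (t : ℝ) : Option (Fin n × Fin n) → Ω → ℝ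
  | none => wignerCharDet η t
  | some p => fun ω => wignerAdj η t ω p.1 p.2

theorem wignerCharDet_succ (ξ : Fin (n + 1) → Fin (n + 1) → Ω → ℝ) (t : ℝ) (ω : Ω) :
    wignerCharDet ξ t ω
      = ∑ a, rowFactor ξ t a ω * minorFactor (fun i j => ξ i.succ j.succ) t a ω := by
  have hsub := symmetricMatrix_sub_smul_submatrix (fun i j => ξ i j ω) (Fin.strictMono_succ (n := n)) t
  have hrow : ∀ i : Fin n, (symmetricMatrix (fun i j => ξ i j ω)
      - t • (1 : Matrix (Fin (n + 1)) (Fin (n + 1)) ℝ)) 0 i.succ = ξ 0 i.succ ω := by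
    intro i
    simp [symmetricMatrix, (Fin.succ_ne_zero i).symm]
  have hcol : ∀ i : Fin n, (symmetricMatrix (fun i j => ξ i j ω)
      - t • (1 : Matrix (Fin (n + 1)) (Fin (n + 1)) ℝ)) i.succ 0 = ξ 0 i.succ ω := by
    intro i
    simp [symmetricMatrix, Fin.succ_ne_zero i]
  rw [wignerCharDet, det_bordered, hsub, Fintype.sum_option, Fintype.sum_prod_type, sub_eq_add_neg,
    ← Finset.sum_neg_distrib]
  congr 1
  · simp [rowFactor, minorFactor, wignerCharDet, symmetricMatrix]
  · refine Finset.sum_congr rfl fun i _ => ?_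
    rw [← Finset.sum_neg_distrib]
    refine Finset.sum_congr rfl fun j _ => ?_
    rw [hrow, hcol]
    simp only [rowFactor, minorFactor, wignerAdj]
    ring

theorem le_minorBound {m : ℕ} (ξ : Fin m → Fin m → Ω → ℝ)
    (p q : {p : Fin m × Fin m // p.1 ≤ p.2}) (ω : Ω) :
    (1 + |ξ p.1.1 p.1.2 ω|) * (1 + |ξ q.1.1 q.1.2 ω|) ≤ minorBound ξ ω := by
  have h1 : ∀ p : {p : Fin m × Fin m // p.1 ≤ p.2}, (1 : ℝ) ≤ 1 + |ξ p.1.1 p.1.2 ω| :=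
    fun p => le_add_of_nonneg_right (abs_nonneg _)
  have hle : ∀ p : {p : Fin m × Fin m // p.1 ≤ p.2},
      1 + |ξ p.1.1 p.1.2 ω| ≤ ∏ r : {p : Fin m × Fin m // p.1 ≤ p.2}, (1 + |ξ r.1.1 r.1.2 ω|) := by
    intro p
    rw [← Finset.mul_prod_erase _ _ (Finset.mem_univ p)]
    exact le_mul_of_one_le_right (zero_le_one.trans (h1 p)) (Finset.one_le_prod fun r _ => h1 r)
  rw [minorBound, Finset.prod_pow, sq]
  exact mul_le_mul (hle p) (hle q) (zero_le_one.trans (h1 q))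
    ((zero_le_one.trans (h1 p)).trans (hle p))

theorem abs_rowFactor_le (ξ : Fin (n + 1) → Fin (n + 1) → Ω → ℝ) (t : ℝ)
    (a : Option (Fin n × Fin n)) (ω : Ω) :
    |rowFactor ξ t a ω| ≤ (2 + |t|) * minorBound ξ ω := by
  have ht := abs_nonneg t
  cases a with
  | none =>
    have h := le_minorBound ξ ⟨(0, 0), le_rfl⟩ ⟨(0, 0), le_rfl⟩ ω
    have h2 : Real.sqrt 2 ≤ 2 := by
      rw [Real.sqrt_le_left (by norm_num)]; norm_num
    have h3 : |rowFactor ξ t none ω| ≤ Real.sqrt 2 * |ξ 0 0 ω| + |t| := by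
      refine (abs_sub _ _).trans ?_
      rw [abs_mul, abs_of_nonneg (Real.sqrt_nonneg 2)]
    have h4 := abs_nonneg (ξ 0 0 ω)
    simp only at h
    nlinarith [mul_nonneg ht h4, mul_le_mul_of_nonneg_left h (by positivity : 0 ≤ 2 + |t|)]
  | some p =>
    have h := le_minorBound ξ ⟨(0, p.1.succ), Fin.zero_le _⟩ ⟨(0, p.2.succ), Fin.zero_le _⟩ ω
    have hW := minorBound_nonneg (ξ := ξ) ω
    simp only at h
    rw [rowFactor, abs_neg, abs_mul]
    have h3 := abs_nonneg (ξ 0 p.1.succ ω)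
    have h4 := abs_nonneg (ξ 0 p.2.succ ω)
    nlinarith [mul_nonneg ht hW]

theorem measurable_rowFactor {m : MeasurableSpace Ω} {ξ : Fin (n + 1) → Fin (n + 1) → Ω → ℝ}
    (hξ : ∀ j, Measurable[m] (ξ 0 j)) (t : ℝ) (a : Option (Fin n × Fin n)) :
    Measurable[m] (rowFactor ξ t a) := by
  cases a with
  | none => exact ((hξ 0).const_mul _).sub_const _
  | some p => exact ((hξ _).mul (hξ _)).neg

theorem measurable_minorFactor {m : MeasurableSpace Ω} {η : Fin n → Fin n → Ω → ℝ}
    (hη : ∀ i j, i ≤ j → Measurable[m] (η i j)) (t : ℝ) (a : Option (Fin n × Fin n)) :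
    Measurable[m] (minorFactor η t a) := by
  cases a with
  | none => exact measurable_wignerCharDet hη t
  | some p => exact measurable_wignerAdj hη t p.1 p.2

theorem abs_minorFactor_le (η : Fin n → Fin n → Ω → ℝ) (t : ℝ)
    (a : Option (Fin n × Fin n)) (ω : Ω) :
    |minorFactor η t a ω| ≤ n.factorial * (2 + |t|) ^ n * minorBound η ω := by
  cases a with
  | none => exact abs_wignerCharDet_le t ω
  | some p => exact abs_wignerAdj_le t ω p.1 p.2

theorem wignerAdj_symm (η : Fin n → Fin n → Ω → ℝ) (t : ℝ) (ω : Ω) (i j : Fin n) :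
    wignerAdj η t ω i j = wignerAdj η t ω j i := by
  have h : (symmetricMatrix (fun i j => η i j ω) - t • (1 : Matrix (Fin n) (Fin n) ℝ)).IsSymm :=
    (isSymm_symmetricMatrix _).sub (Matrix.isSymm_one.smul t)
  exact (h.adjugate.apply i j).symm

variable [MeasurableSpace Ω] {P : Measure Ω} {Q : Measure ℝ}

/-- The row factors involve only the first row and the minor factors only the remaining entries, so
every expectation in the expanded product splits. -/
theorem corrFun_succ_eq_sum [IsProbabilityMeasure Q] (hfourth : Integrable (fun x : ℝ => x ^ 4) Q)
    {ξ : Fin (n + 1) → Fin (n + 1) → Ω → ℝ}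
    (hξ : IsIIDUpperTriangle P Q ξ) (hm : ∀ i j, Measurable (ξ i j)) (μ ν : ℝ) :
    corrFun P ξ μ ν = ∑ a, ∑ b, (∫ ω, rowFactor ξ μ a ω * rowFactor ξ ν b ω ∂P)
      * ∫ ω, minorFactor (fun i j => ξ i.succ j.succ) μ a ω
          * minorFactor (fun i j => ξ i.succ j.succ) ν b ω ∂P := by
  set η : Fin n → Fin n → Ω → ℝ := fun i j => ξ i.succ j.succ with hη_def
  have hη : IsIIDUpperTriangle P Q η := hξ.comp_strictMono Fin.strictMono_succ
  have hηm : ∀ i j, i ≤ j → Measurable (η i j) := fun i j _ => hm _ _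
  set X : {p : Fin (n + 1) × Fin (n + 1) // p.1 ≤ p.2} → Ω → ℝ := fun p => ξ p.1.1 p.1.2
  have hd : Disjoint {p : {p : Fin (n + 1) × Fin (n + 1) // p.1 ≤ p.2} | p.1.1 = 0}
      {p | p.1.1 ≠ 0} := disjoint_compl_right
  have hrow : ∀ j, Measurable[sigmaOf X {p | p.1.1 = 0}] (ξ 0 j) := fun j =>
    measurable_sigmaOf X (i := ⟨(0, j), Fin.zero_le _⟩) rfl
  have hmin : ∀ i j, i ≤ j → Measurable[sigmaOf X {p | p.1.1 ≠ 0}] (η i j) := fun i j hij =>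
    measurable_sigmaOf X (i := ⟨(i.succ, j.succ), Fin.succ_le_succ_iff.2 hij⟩)
      (Fin.succ_ne_zero i)
  have hind : ∀ a b, IndepFun (fun ω => rowFactor ξ μ a ω * rowFactor ξ ν b ω)
      (fun ω => minorFactor η μ a ω * minorFactor η ν b ω) P := fun a b =>
    indepFun_of_measurable_sigmaOf hξ.indep (fun p => hm _ _) hd
      ((measurable_rowFactor hrow μ a).mul (measurable_rowFactor hrow ν b))
      ((measurable_minorFactor hmin μ a).mul (measurable_minorFactor hmin ν b))
  have hint : ∀ a b, Integrable (fun ω => (rowFactor ξ μ a ω * rowFactor ξ ν b ω)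
      * (minorFactor η μ a ω * minorFactor η ν b ω)) P := fun a b =>
    -- Independence yields integrability from the two blocks separately, so fourth moments still
    -- suffice.
    (hind a b).integrable_mul
      (integrable_mul_of_abs_le_minorBound hfourth hξ (measurable_rowFactor (fun j => hm 0 j) μ a)
        (measurable_rowFactor (fun j => hm 0 j) ν b) (abs_rowFactor_le ξ μ a)
        (abs_rowFactor_le ξ ν b))
      (integrable_mul_of_abs_le_minorBound hfourth hη (measurable_minorFactor hηm μ a)
        (measurable_minorFactor hηm ν b) (abs_minorFactor_le η μ a) (abs_minorFactor_le η ν b))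
  have hexp : ∀ ω, wignerCharDet ξ μ ω * wignerCharDet ξ ν ω
      = ∑ a, ∑ b, (rowFactor ξ μ a ω * rowFactor ξ ν b ω)
        * (minorFactor η μ a ω * minorFactor η ν b ω) := by
    intro ω
    rw [wignerCharDet_succ, wignerCharDet_succ, Finset.sum_mul_sum]
    exact Finset.sum_congr rfl fun a _ => Finset.sum_congr rfl fun b _ => by ring
  simp only [corrFun, hexp]
  rw [integral_finsetSum _ fun a _ => integrable_finsetSum _ fun b _ => hint a b]
  refine Finset.sum_congr rfl fun a _ => ?_
  rw [integral_finsetSum _ fun b _ => hint a b]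
  refine Finset.sum_congr rfl fun b _ => ?_
  exact (hind a b).integral_fun_mul_eq_mul_integral
    ((measurable_rowFactor (fun j => hm 0 j) μ a).mul
      (measurable_rowFactor (fun j => hm 0 j) ν b)).aestronglyMeasurable
    ((measurable_minorFactor hηm μ a).mul (measurable_minorFactor hηm ν b)).aestronglyMeasurable

/-- The diagonal cofactors contribute the correlation function of the next smaller dimension. -/
theorem corrFun_succAbove (η : Fin (n + 1) → Fin (n + 1) → Ω → ℝ) (i : Fin (n + 1)) (μ ν : ℝ) :
    ∫ ω, wignerAdj η μ ω i i * wignerAdj η ν ω i i ∂P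
      = corrFun P (fun k l => η (i.succAbove k) (i.succAbove l)) μ ν := by
  have h : ∀ t ω, wignerAdj η t ω i i
      = wignerCharDet (fun k l => η (i.succAbove k) (i.succAbove l)) t ω := by
    intro t ω
    rw [wignerAdj, Matrix.adjugate_fin_succ_eq_det_submatrix,
      symmetricMatrix_sub_smul_submatrix _ (Fin.strictMono_succAbove i), ← two_mul, pow_mul]
    simp [wignerCharDet]
  simp only [h, corrFun]

section RowMoments

variable {ξ : Fin (n + 1) → Fin (n + 1) → Ω → ℝ}

theorem iIndepFun_row (hξ : IsIIDUpperTriangle P Q ξ) : iIndepFun (fun j => ξ 0 j) P :=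
  hξ.indep.precomp (g := fun j : Fin (n + 1) =>
    (⟨(0, j), Fin.zero_le _⟩ : {p : Fin (n + 1) × Fin (n + 1) // p.1 ≤ p.2}))
    fun i j hij => by simpa using hij

theorem integral_rowFactor_some_some (hmean : ∫ x, x ∂Q = 0) (hvar : ∫ x, x ^ 2 ∂Q = 1)
    (hξ : IsIIDUpperTriangle P Q ξ) (hm : ∀ i j, Measurable (ξ i j)) (μ ν : ℝ) (i j k l : Fin n) :
    ∫ ω, rowFactor ξ μ (some (i, j)) ω * rowFactor ξ ν (some (k, l)) ω ∂P
      = (if i = j then if k = l then 1 else 0 else 0) + (if i = k then if j = l then 1 else 0 else 0)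
        + (if i = l then if j = k then 1 else 0 else 0)
        + ((∫ x, x ^ 4 ∂Q) - 3)
          * (if i = j then if i = k then if i = l then 1 else 0 else 0 else 0) := by
  have := integral_mul_four_of_iIndepFun (iIndepFun_row hξ) (fun j => hm 0 j)
    (fun j => hξ.hasLaw 0 j (Fin.zero_le _)) hmean hvar i.succ j.succ k.succ l.succ
  simp only [Fin.succ_inj] at this
  simpa [rowFactor] using this

variable [IsProbabilityMeasure P]

theorem integrable_of_hasLaw {X : Ω → ℝ} (h : HasLaw X Q P) (hX : Measurable X)
    (hvar : ∫ x, x ^ 2 ∂Q = 1) : Integrable X P ∧ Integrable (fun ω => X ω ^ 2) P := by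
  have h2 : ∫ ω, X ω ^ 2 ∂P = 1 := by rw [hasLaw_integral_pow h 2, hvar]
  -- A non-integrable function has integral `0` by convention, so the value `1` forces
  -- integrability.
  have hi2 : Integrable (fun ω => X ω ^ 2) P := by
    by_contra h
    rw [integral_undef h] at h2
    exact zero_ne_one h2
  refine ⟨((integrable_const 1).add hi2).mono' hX.aestronglyMeasurable
      (ae_of_all _ fun ω => ?_), hi2⟩
  rw [Real.norm_eq_abs, abs_le]
  constructor <;> simp only [Pi.add_apply] <;>
    nlinarith [sq_nonneg (X ω + 1), sq_nonneg (X ω - 1)]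

theorem integral_rowFactor_none_none (hmean : ∫ x, x ∂Q = 0) (hvar : ∫ x, x ^ 2 ∂Q = 1)
    (hξ : IsIIDUpperTriangle P Q ξ) (hm : ∀ i j, Measurable (ξ i j)) (μ ν : ℝ) :
    ∫ ω, rowFactor ξ μ none ω * rowFactor ξ ν none ω ∂P = 2 + μ * ν := by
  have h00 := hξ.hasLaw 0 0 le_rfl
  have h1 : ∫ ω, ξ 0 0 ω ∂P = 0 := by simpa [hmean] using hasLaw_integral_pow h00 1
  have h2 : ∫ ω, ξ 0 0 ω ^ 2 ∂P = 1 := by rw [hasLaw_integral_pow h00 2, hvar]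
  obtain ⟨hi1, hi2⟩ := integrable_of_hasLaw h00 (hm 0 0) hvar
  have hexp : ∀ ω, rowFactor ξ μ none ω * rowFactor ξ ν none ω
      = 2 * ξ 0 0 ω ^ 2 - (Real.sqrt 2 * (μ + ν)) * ξ 0 0 ω + μ * ν := by
    intro ω
    have := Real.mul_self_sqrt (show (0 : ℝ) ≤ 2 by norm_num)
    simp only [rowFactor]
    linear_combination ξ 0 0 ω ^ 2 * this
  simp only [hexp]
  have hi : Integrable (fun ω => 2 * ξ 0 0 ω ^ 2 - (Real.sqrt 2 * (μ + ν)) * ξ 0 0 ω) P :=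
    (hi2.const_mul _).sub (hi1.const_mul _)
  rw [integral_add hi (integrable_const _), integral_sub (hi2.const_mul _) (hi1.const_mul _), integral_const_mul, integral_const_mul, h1, h2]
  simp

theorem integral_rowFactor_none_some (hmean : ∫ x, x ∂Q = 0) (hvar : ∫ x, x ^ 2 ∂Q = 1)
    (hξ : IsIIDUpperTriangle P Q ξ) (hm : ∀ i j, Measurable (ξ i j)) (μ ν : ℝ) (p : Fin n × Fin n) :
    ∫ ω, rowFactor ξ μ none ω * rowFactor ξ ν (some p) ω ∂P = if p.1 = p.2 then μ else 0 := by
  have hrow := iIndepFun_row hξ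
  have hd : Disjoint ({0} : Set (Fin (n + 1))) ({p.1.succ, p.2.succ} : Set (Fin (n + 1))) := by
    simp [(Fin.succ_ne_zero _).symm]
  have hind : IndepFun (rowFactor ξ μ none) (rowFactor ξ ν (some p)) P :=
    indepFun_of_measurable_sigmaOf hrow (fun j => hm 0 j) hd
      (((measurable_sigmaOf _ (Set.mem_singleton 0)).const_mul _).sub_const _)
      ((measurable_sigmaOf (fun j => ξ 0 j) (i := p.1.succ) (by simp)).mul
        (measurable_sigmaOf (fun j => ξ 0 j) (i := p.2.succ) (by simp))).neg
  have h00 := hξ.hasLaw 0 0 le_rfl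
  have h1 : ∫ ω, ξ 0 0 ω ∂P = 0 := by simpa [hmean] using hasLaw_integral_pow h00 1
  have hi1 := (integrable_of_hasLaw h00 (hm 0 0) hvar).1
  rw [hind.integral_fun_mul_eq_mul_integral
    (measurable_rowFactor (fun j => hm 0 j) μ none).aestronglyMeasurable
    (measurable_rowFactor (fun j => hm 0 j) ν (some p)).aestronglyMeasurable]
  simp only [rowFactor]
  rw [integral_sub (hi1.const_mul _) (integrable_const _), integral_const_mul, h1, integral_neg,
    integral_mul_of_iIndepFun hrow (fun j => hm 0 j) (fun j => hξ.hasLaw 0 j (Fin.zero_le _))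
      hmean hvar]
  by_cases h : p.1 = p.2 <;> simp [h]

end RowMoments

variable [IsProbabilityMeasure P] [IsProbabilityMeasure Q]

/-- The corner entry, of variance `2`, gives `2 + μ ν`; its mean `-μ` or `-ν` against a quadratic
term gives the mixed determinant-trace terms. Of the three pairings of four row entries, one gives
the product of traces and the other two each give the trace of the product; the fourth cumulant
selects the diagonal cofactors. -/
theorem corrFun_succ (hmean : ∫ x, x ∂Q = 0) (hvar : ∫ x, x ^ 2 ∂Q = 1)
    (hfourth : Integrable (fun x : ℝ => x ^ 4) Q) {ξ : Fin (n + 1) → Fin (n + 1) → Ω → ℝ}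
    (hξ : IsIIDUpperTriangle P Q ξ) (hm : ∀ i j, Measurable (ξ i j))
    {η : Fin n → Fin n → Ω → ℝ} (hη_def : η = fun i j => ξ i.succ j.succ) (μ ν : ℝ) :
    corrFun P ξ μ ν = (2 + μ * ν) * corrFun P η μ ν
      + μ * ∫ ω, wignerCharDet η μ ω * (wignerAdj η ν ω).trace ∂P
      + ν * ∫ ω, wignerCharDet η ν ω * (wignerAdj η μ ω).trace ∂P
      + ∫ ω, (wignerAdj η μ ω).trace * (wignerAdj η ν ω).trace ∂P
      + 2 * ∫ ω, (wignerAdj η μ ω * wignerAdj η ν ω).trace ∂P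
      + ((∫ x, x ^ 4 ∂Q) - 3) * ∑ i, ∫ ω, wignerAdj η μ ω i i * wignerAdj η ν ω i i ∂P := by
  have hη : IsIIDUpperTriangle P Q η := hη_def ▸ hξ.comp_strictMono Fin.strictMono_succ
  have hηm : ∀ i j, i ≤ j → Measurable (η i j) := fun i j _ => by rw [hη_def]; exact hm _ _
  have hI : ∀ s t a b, Integrable (fun ω => minorFactor η s a ω * minorFactor η t b ω) P :=
    fun s t a b => integrable_mul_of_abs_le_minorBound hfourth hη (measurable_minorFactor hηm s a)
        (measurable_minorFactor hηm t b) (abs_minorFactor_le η s a) (abs_minorFactor_le η t b)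
  have hA : ∀ i j k l, Integrable (fun ω => wignerAdj η μ ω i j * wignerAdj η ν ω k l) P :=
    fun i j k l => hI μ ν (some (i, j)) (some (k, l))
  have hD : ∀ s t i, Integrable (fun ω => wignerCharDet η s ω * wignerAdj η t ω i i) P :=
    fun s t i => hI s t none (some (i, i))
  rw [corrFun_succ_eq_sum hfourth hξ hm, ← hη_def]
  have hdet : ∀ s t, ∫ ω, wignerCharDet η s ω * (wignerAdj η t ω).trace ∂P
      = ∑ i, ∫ ω, wignerCharDet η s ω * wignerAdj η t ω i i ∂P := by
    intro s t
    rw [← integral_finsetSum _ fun i _ => hD s t i]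
    simp [Matrix.trace, Finset.mul_sum]
  have htr : ∫ ω, (wignerAdj η μ ω).trace * (wignerAdj η ν ω).trace ∂P
      = ∑ i, ∑ k, ∫ ω, wignerAdj η μ ω i i * wignerAdj η ν ω k k ∂P := by
    simp only [← integral_finsetSum _ fun k _ => hA _ _ k k]
    rw [← integral_finsetSum _ fun i _ => integrable_finsetSum _ fun k _ => hA i i k k]
    simp [Matrix.trace, Finset.sum_mul_sum]
  have htm : ∫ ω, (wignerAdj η μ ω * wignerAdj η ν ω).trace ∂P
      = ∑ i, ∑ j, ∫ ω, wignerAdj η μ ω i j * wignerAdj η ν ω j i ∂P := by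
    have : ∀ i, ∑ j, ∫ ω, wignerAdj η μ ω i j * wignerAdj η ν ω j i ∂P
        = ∫ ω, ∑ j, wignerAdj η μ ω i j * wignerAdj η ν ω j i ∂P := fun i =>
      (integral_finsetSum _ fun j _ => hA i j j i).symm
    simp only [this]
    rw [← integral_finsetSum _ fun i _ => integrable_finsetSum _ fun j _ => hA i j j i]
    simp [Matrix.trace, Matrix.mul_apply]
  -- By symmetry of the adjugate the two crossed pairings contribute equally.
  have htm' : ∑ i, ∑ j, ∫ ω, wignerAdj η μ ω i j * wignerAdj η ν ω i j ∂P
      = ∑ i, ∑ j, ∫ ω, wignerAdj η μ ω i j * wignerAdj η ν ω j i ∂P := by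
    refine Finset.sum_congr rfl fun i _ => Finset.sum_congr rfl fun j _ => ?_
    simp only [wignerAdj_symm η ν _ i j]
  have hns : ∀ s t p, ∫ ω, rowFactor ξ s (some p) ω * rowFactor ξ t none ω ∂P
      = if p.1 = p.2 then t else 0 := by
    intro s t p
    simpa only [mul_comm] using integral_rowFactor_none_some hmean hvar hξ hm t s p
  simp only [Fintype.sum_option, Fintype.sum_prod_type, hns,
    integral_rowFactor_none_none hmean hvar hξ hm,
    integral_rowFactor_none_some hmean hvar hξ hm, integral_rowFactor_some_some hmean hvar hξ hm,
    minorFactor, hdet, htr, htm]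
  have hss : ∑ i, ∑ j, ∑ k, ∑ l,
      ((if i = j then if k = l then 1 else 0 else 0) + (if i = k then if j = l then 1 else 0 else 0)
        + (if i = l then if j = k then 1 else 0 else 0)
        + ((∫ x, x ^ 4 ∂Q) - 3)
          * (if i = j then if i = k then if i = l then 1 else 0 else 0 else 0))
        * ∫ ω, wignerAdj η μ ω i j * wignerAdj η ν ω k l ∂P
      = (∑ i, ∑ k, ∫ ω, wignerAdj η μ ω i i * wignerAdj η ν ω k k ∂P)
        + 2 * (∑ i, ∑ j, ∫ ω, wignerAdj η μ ω i j * wignerAdj η ν ω j i ∂P)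
        + ((∫ x, x ^ 4 ∂Q) - 3) * ∑ i, ∫ ω, wignerAdj η μ ω i i * wignerAdj η ν ω i i ∂P := by
    rw [two_mul]
    nth_rewrite 2 [← htm']
    simp only [add_mul, Finset.sum_add_distrib, mul_assoc, ← Finset.mul_sum, ite_mul, zero_mul,
      one_mul, sum_ite_of_const, Finset.sum_ite_eq, Finset.mem_univ, if_true]
    ring
  have hcomm : ∀ i j, ∫ ω, wignerAdj η μ ω i j * wignerCharDet η ν ω ∂P
      = ∫ ω, wignerCharDet η ν ω * wignerAdj η μ ω i j ∂P := fun i j => by simp only [mul_comm]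
  simp only [Finset.sum_add_distrib, hcomm]
  rw [hss]
  simp only [ite_mul, zero_mul, Finset.sum_ite_eq, Finset.mem_univ, if_true,
    ← Finset.mul_sum]
  rw [corrFun]
  ring

/-- Uniqueness of derivatives matches the data of `CorrStep` with the expectations in
`corrFun_succ`. The divided difference is determined only off the diagonal, whence `μ ≠ ν`. -/
theorem corrFun_succ_of_corrStep (hmean : ∫ x, x ∂Q = 0) (hvar : ∫ x, x ^ 2 ∂Q = 1)
    (hfourth : Integrable (fun x : ℝ => x ^ 4) Q) {ξ : Fin (n + 1) → Fin (n + 1) → Ω → ℝ}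
    (hξ : IsIIDUpperTriangle P Q ξ) (hm : ∀ i j, Measurable (ξ i j))
    {η : Fin n → Fin n → Ω → ℝ} (hη_def : η = fun i j => ξ i.succ j.succ) {R : ℝ → ℝ → ℝ}
    (hR : CorrStep (corrFun P η) R) {μ ν : ℝ} (hμν : μ ≠ ν) :
    corrFun P ξ μ ν = R μ ν
      + ((∫ x, x ^ 4 ∂Q) - 3) * ∑ i, ∫ ω, wignerAdj η μ ω i i * wignerAdj η ν ω i i ∂P := by
  have hη : IsIIDUpperTriangle P Q η := hη_def ▸ hξ.comp_strictMono Fin.strictMono_succ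
  have hηm : ∀ i j, Measurable (η i j) := fun i j => by rw [hη_def]; exact hm _ _
  rw [corrFun_succ hmean hvar hfourth hξ hm hη_def]
  obtain ⟨Gx, Gy, Gxy, T, h1, h2, h3, h4, h5⟩ := hR
  have e1 := (h1 μ ν).unique (hasDerivAt_corrFun_left hfourth hη hηm μ ν)
  have e2 : ∀ s, Gy s ν = _ := fun s =>
    (h2 s ν).unique (hasDerivAt_corrFun_right hfourth hη hηm s ν)
  have e3 : Gxy μ ν = ∫ ω, (wignerAdj η μ ω).trace * (wignerAdj η ν ω).trace ∂P := by
    have := h3 μ ν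
    simp only [e2] at this
    exact this.unique (hasDerivAt_integral_det_mul_trace hfourth hη hηm μ ν)
  have e4 : T μ ν = ∫ ω, (wignerAdj η μ ω * wignerAdj η ν ω).trace ∂P := by
    refine mul_left_cancel₀ (sub_ne_zero.2 hμν.symm) ?_
    rw [h4, sub_mul_integral_trace_wignerAdj_mul hfourth hη hηm, e1, e2]
    ring
  rw [h5, e1, e2, e3, e4]
  ring

theorem continuous_corrPoly_left (a : ℝ) (n : ℕ) (y : ℝ) :
    Continuous fun x => corrPoly a n x y := by
  obtain ⟨Gx, -, -, -, h, -⟩ := corrStep_corrPoly a n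
  exact continuous_iff_continuousAt.2 fun x => (h x y).continuousAt

end Recursion

/-- The exact formula for the second-order correlation function. -/
theorem corrFun_eq_corrPoly {Ω : Type*} [MeasurableSpace Ω] {P : Measure Ω}
    [IsProbabilityMeasure P] {Q : Measure ℝ} [IsProbabilityMeasure Q]
    (hmean : ∫ x, x ∂Q = 0) (hvar : ∫ x, x ^ 2 ∂Q = 1)
    (hfourth : Integrable (fun x : ℝ => x ^ 4) Q) (n : ℕ) (ξ : Fin n → Fin n → Ω → ℝ)
    (hξ : IsIIDUpperTriangle P Q ξ) (hm : ∀ i j, Measurable (ξ i j)) :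
    corrFun P ξ = fun μ ν => n.factorial * corrPoly (((∫ x, x ^ 4 ∂Q) - 3) / 2) n μ ν := by
  induction n using Nat.strong_induction_on with
  | _ n ih =>
    set a := ((∫ x, x ^ 4 ∂Q) - 3) / 2 with ha
    cases n with
    | zero =>
      ext μ ν
      simp [corrFun, wignerCharDet, corrPoly_zero]
    | succ n =>
      set η : Fin n → Fin n → Ω → ℝ := fun i j => ξ i.succ j.succ with hη_def
      have hη : IsIIDUpperTriangle P Q η := hξ.comp_strictMono Fin.strictMono_succ
      have hG := ih n n.lt_succ_self η hη fun i j => hm _ _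
      have hstep := (corrStep_corrPoly a n).const_smul n.factorial
      rw [show (n.factorial : ℝ) • corrPoly a n = corrFun P η from hG.symm] at hstep
      -- Deleting the `i`-th row and column leaves an i.i.d. upper triangle again, so each diagonal
      -- cofactor gives the correlation function two dimensions below `ξ`. This is the term that
      -- cancels the correction in `corrStep_corrPoly`. In dimension zero both sides vanish.
      have hdiag : ∀ μ ν, ((∫ x, x ^ 4 ∂Q) - 3)
            * ∑ i, ∫ ω, wignerAdj η μ ω i i * wignerAdj η ν ω i i ∂P
          = n.factorial * (2 * a * ∑ k ∈ Finset.range (n + 1),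
              a ^ k / k.factorial * hermiteSumTwo (n + 1 - 2 * k) μ ν) := by
        intro μ ν
        cases n with
        | zero => simp
        | succ n =>
          have hi : ∀ i, ∫ ω, wignerAdj η μ ω i i * wignerAdj η ν ω i i ∂P
              = n.factorial * corrPoly a n μ ν := by
            intro i
            rw [corrFun_succAbove, ih n (by omega) (fun k l => η (i.succAbove k) (i.succAbove l))
              (hη.comp_strictMono (Fin.strictMono_succAbove i)) fun k l => hm _ _]
          simp only [hi, Finset.sum_const, Finset.card_univ, Fintype.card_fin, nsmul_eq_mul]
          rw [corrPoly_eq_sum a (Nat.le_succ (n + 1)), Nat.factorial_succ, ha]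
          push_cast
          ring
      have hne : ∀ μ ν, μ ≠ ν → corrFun P ξ μ ν = (n + 1).factorial * corrPoly a (n + 1) μ ν := by
        intro μ ν hμν
        rw [corrFun_succ_of_corrStep hmean hvar hfourth hξ hm hη_def hstep hμν, hdiag,
          Nat.factorial_succ]
        simp only [Pi.smul_apply, smul_eq_mul]
        push_cast
        ring
      ext μ ν
      -- The diagonal is recovered from continuity in the first variable.
      refine congrFun (Continuous.ext_on (dense_compl_singleton ν) ?_ ?_
        (fun s hs => hne s ν hs)) μ
      · exact continuous_iff_continuousAt.2 fun s =>
          (hasDerivAt_corrFun_left hfourth hξ hm s ν).continuousAt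
      · exact (continuous_corrPoly_left a (n + 1) ν).const_mul _

theorem integrable_wignerCharDet_mul {Ω : Type*} [MeasurableSpace Ω] {P : Measure Ω}
    {Q : Measure ℝ} [IsProbabilityMeasure Q] (hfourth : Integrable (fun x : ℝ => x ^ 4) Q) {n : ℕ}
    {ξ : Fin n → Fin n → Ω → ℝ} (hξ : IsIIDUpperTriangle P Q ξ) (hm : ∀ i j, Measurable (ξ i j))
    (μ ν : ℝ) : Integrable (fun ω => wignerCharDet ξ μ ω * wignerCharDet ξ ν ω) P :=
  integrable_mul_of_abs_le_minorBound hfourth hξ (measurable_wignerCharDet (fun i j _ => hm i j) μ)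
    (measurable_wignerCharDet (fun i j _ => hm i j) ν) (abs_wignerCharDet_le μ)
    (abs_wignerCharDet_le ν)

/-- The entries may be replaced by measurable ones without changing the determinants. -/
theorem exists_measurable_modification {Ω : Type*} [MeasurableSpace Ω] {P : Measure Ω}
    {Q : Measure ℝ} {n : ℕ} {ξ : Fin n → Fin n → Ω → ℝ} (hξ : IsIIDUpperTriangle P Q ξ) :
    ∃ ξ' : Fin n → Fin n → Ω → ℝ, IsIIDUpperTriangle P Q ξ' ∧ (∀ i j, Measurable (ξ' i j)) ∧
      ∀ᵐ ω ∂P, ∀ t, wignerCharDet ξ t ω = wignerCharDet ξ' t ω := by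
  -- Nothing is known about the entries below the diagonal, and they never enter the matrix; they
  -- are set to `0`.
  set ξ' : Fin n → Fin n → Ω → ℝ := fun i j =>
    if h : i ≤ j then (hξ.hasLaw i j h).aemeasurable.mk _ else 0 with hξ'
  have hae : ∀ i j, i ≤ j → ξ i j =ᵐ[P] ξ' i j := by
    intro i j h
    simp only [hξ', h, dif_pos]
    exact (hξ.hasLaw i j h).aemeasurable.ae_eq_mk
  refine ⟨ξ', ⟨fun i j h => (hξ.hasLaw i j h).congr (hae i j h).symm,
    hξ.indep.congr fun p => hae _ _ p.2⟩, fun i j => ?_, ?_⟩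
  · by_cases h : i ≤ j
    · simp only [hξ', h, dif_pos]
      exact (hξ.hasLaw i j h).aemeasurable.measurable_mk
    · simp only [hξ', h, dif_neg, not_false_eq_true]
      exact measurable_const
  · have hall : ∀ᵐ ω ∂P, ∀ i j, i ≤ j → ξ i j ω = ξ' i j ω := by
      simp only [ae_all_iff]
      exact hae
    filter_upwards [hall] with ω hω t
    have : symmetricMatrix (fun i j => ξ i j ω) = symmetricMatrix (fun i j => ξ' i j ω) := by
      ext i j
      simp only [symmetricMatrix, Matrix.of_apply]
      split_ifs with h1 h2
      · exact hω i j h1.le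
      · rw [hω i i le_rfl]
      · exact hω j i (le_of_not_gt h1)
    rw [wignerCharDet, wignerCharDet, this]

/-! ### Hermite polynomials at the edge and the Airy function -/

section HermiteIntegral

open Complex

theorem integrable_exp_neg_mul_sq_add_mul_abs {a : ℝ} (ha : 0 < a) (b : ℝ) :
    Integrable fun t : ℝ => Real.exp (-a * t ^ 2 + b * |t|) := by
  refine ((integrable_exp_neg_mul_sq (half_pos ha)).const_mul (Real.exp (b ^ 2 / (2 * a)))).mono'
    (by fun_prop) (ae_of_all _ fun t => ?_)
  rw [Real.norm_of_nonneg (Real.exp_pos _).le, ← Real.exp_add]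
  refine Real.exp_le_exp.2 ?_
  have h : b ^ 2 / (2 * a) + -(a / 2) * t ^ 2 - (-a * t ^ 2 + b * |t|)
      = (a * |t| - b) ^ 2 / (2 * a) := by
    rw [← sq_abs t]
    field_simp
    ring
  have : 0 ≤ (a * |t| - b) ^ 2 / (2 * a) := by positivity
  linarith

theorem integrable_pow_mul_cexp_sq (n : ℕ) (c : ℝ) (x : ℂ) :
    Integrable fun t : ℝ => ((c : ℂ) + t * I) ^ n * cexp ((c + t * I - x) ^ 2 / 2) := by
  refine ((integrable_exp_neg_mul_sq_add_mul_abs (a := 1 / 2) (by norm_num) (1 + |x.im|)).const_mul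
    (n.factorial * Real.exp (|c| + (c - x.re) ^ 2 / 2))).mono'
    (by fun_prop) (ae_of_all _ fun t => ?_)
  rw [norm_mul, norm_pow, norm_exp]
  have h1 : ‖(c : ℂ) + t * I‖ ≤ |c| + |t| := by
    refine (norm_add_le _ _).trans ?_
    simp
  have h2 : (|c| + |t|) ^ n ≤ n.factorial * Real.exp (|c| + |t|) := by
    have := Real.pow_div_factorial_le_exp (|c| + |t|) (by positivity) n
    rwa [div_le_iff₀' (by positivity)] at this
  have h3 : (((c : ℂ) + t * I - x) ^ 2 / 2).re = ((c - x.re) ^ 2 - (t - x.im) ^ 2) / 2 := by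
    rw [show ((c : ℂ) + t * I - x) ^ 2 / 2 = (((1 / 2 : ℝ) : ℂ)) * ((c : ℂ) + t * I - x) ^ 2 by
      push_cast; ring, re_ofReal_mul]
    simp [sq]
    ring
  have h4 : ((c - x.re) ^ 2 - (t - x.im) ^ 2) / 2
      ≤ (c - x.re) ^ 2 / 2 + (-(1 / 2) * t ^ 2 + |x.im| * |t|) := by
    have := le_abs_self (x.im * t)
    rw [abs_mul] at this
    nlinarith [sq_nonneg x.im]
  calc ‖(c : ℂ) + t * I‖ ^ n * Real.exp (((c : ℂ) + t * I - x) ^ 2 / 2).re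
      ≤ (n.factorial * Real.exp (|c| + |t|))
          * Real.exp ((c - x.re) ^ 2 / 2 + (-(1 / 2) * t ^ 2 + |x.im| * |t|)) := by
        rw [h3]
        gcongr
        exact (pow_le_pow_left₀ (norm_nonneg _) h1 n).trans h2
    _ = _ := by
        rw [mul_assoc, mul_assoc, ← Real.exp_add, ← Real.exp_add]
        congr 2
        ring

/-- The integral representation of the Hermite polynomials along a vertical line. -/
theorem integral_pow_mul_cexp_sq (n : ℕ) (c : ℝ) (x : ℂ) :
    ∫ t : ℝ, ((c : ℂ) + t * I) ^ n * cexp ((c + t * I - x) ^ 2 / 2)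
      = Real.sqrt (2 * Real.pi) * hermiteVal n x := by
  have hline : ∀ t : ℝ, HasDerivAt (fun t : ℝ => (c : ℂ) + t * I) I t := fun t => by
    simpa using (((hasDerivAt_id t).ofReal_comp).mul_const I).const_add (c : ℂ)
  have hexp : ∀ t : ℝ, HasDerivAt (fun t : ℝ => cexp (((c : ℂ) + t * I - x) ^ 2 / 2))
      (I * ((c : ℂ) + t * I - x) * cexp (((c : ℂ) + t * I - x) ^ 2 / 2)) t := fun t => by
    refine ((((hline t).sub_const x).pow 2).div_const 2).cexp.congr_deriv ?_
    simp
    ring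
  have h0 : ∫ t : ℝ, cexp (((c : ℂ) + t * I - x) ^ 2 / 2) = Real.sqrt (2 * Real.pi) := by
    have := integral_cexp_quadratic (b := -1 / 2) (by norm_num) (I * (c - x)) ((c - x) ^ 2 / 2)
    rw [show (fun t : ℝ => cexp (((c : ℂ) + t * I - x) ^ 2 / 2))
      = fun t : ℝ => cexp (-1 / 2 * (t : ℂ) ^ 2 + I * (c - x) * t + (c - x) ^ 2 / 2) by
        ext t; congr 1; linear_combination (t : ℂ) ^ 2 / 2 * I_sq, this]
    rw [show ((c : ℂ) - x) ^ 2 / 2 - (I * (c - x)) ^ 2 / (4 * (-1 / 2)) = 0 by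
        linear_combination ((c : ℂ) - x) ^ 2 / 2 * I_sq, Complex.exp_zero, mul_one,
      Real.sqrt_eq_rpow, ofReal_cpow (by positivity)]
    congr 1
    · push_cast; ring
    · push_cast; ring
  have h1 : ∫ t : ℝ, ((c : ℂ) + t * I) * cexp (((c : ℂ) + t * I - x) ^ 2 / 2)
      = x * Real.sqrt (2 * Real.pi) := by
    have i0 := integrable_pow_mul_cexp_sq 0 c x
    have i1 := integrable_pow_mul_cexp_sq 1 c x
    simp only [pow_zero, one_mul, pow_one] at i0 i1
    have hd : ∀ t : ℝ, HasDerivAt (fun t : ℝ => cexp (((c : ℂ) + t * I - x) ^ 2 / 2))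
        (I * (((c : ℂ) + t * I) * cexp (((c : ℂ) + t * I - x) ^ 2 / 2)
          - x * cexp (((c : ℂ) + t * I - x) ^ 2 / 2))) t := fun t =>
      (hexp t).congr_deriv (by ring)
    have := integral_eq_zero_of_hasDerivAt_of_integrable hd ((i1.sub (i0.const_mul x)).const_mul I)
      i0
    rw [integral_const_mul, integral_sub i1 (i0.const_mul x), integral_const_mul, h0] at this
    have := (mul_eq_zero.1 this).resolve_left I_ne_zero
    linear_combination this
  induction n using Nat.strong_induction_on with
  | _ n ih =>
    match n with
    | 0 => simpa using h0
    | 1 =>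
      rw [hermiteVal_succ]
      simp only [pow_one, h1, hermiteVal_zero, hermiteDer_zero]
      ring
    | n + 2 =>
      have i0 := integrable_pow_mul_cexp_sq n c x
      have i1 := integrable_pow_mul_cexp_sq (n + 1) c x
      have i2 := integrable_pow_mul_cexp_sq (n + 2) c x
      -- The integral of this derivative vanishes, which gives `I_{n+2} = x I_{n+1} - (n + 1) I_n`,
      -- the Hermite recurrence. The argument works on every vertical line, so no contour has to be
      -- shifted.
      have hd : ∀ t : ℝ, HasDerivAt
          (fun t : ℝ => ((c : ℂ) + t * I) ^ (n + 1) * cexp (((c : ℂ) + t * I - x) ^ 2 / 2))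
          (I * ((((n : ℂ) + 1) * (((c : ℂ) + t * I) ^ n * cexp (((c : ℂ) + t * I - x) ^ 2 / 2))
            + ((c : ℂ) + t * I) ^ (n + 2) * cexp (((c : ℂ) + t * I - x) ^ 2 / 2))
            - x * (((c : ℂ) + t * I) ^ (n + 1) * cexp (((c : ℂ) + t * I - x) ^ 2 / 2)))) t := by
        intro t
        refine (((hline t).pow (n + 1)).mul (hexp t)).congr_deriv ?_
        simp only [Pi.pow_apply, Nat.add_sub_cancel]
        push_cast
        ring
      have := integral_eq_zero_of_hasDerivAt_of_integrable hd
        (((((i0.const_mul ((n : ℂ) + 1))).add i2).sub (i1.const_mul x)).const_mul I) i1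
      have i02 : Integrable fun t : ℝ =>
          ((n : ℂ) + 1) * (((c : ℂ) + t * I) ^ n * cexp (((c : ℂ) + t * I - x) ^ 2 / 2))
            + ((c : ℂ) + t * I) ^ (n + 2) * cexp (((c : ℂ) + t * I - x) ^ 2 / 2) :=
        (i0.const_mul _).add i2
      rw [integral_const_mul, integral_sub i02 (i1.const_mul x),
        integral_add (i0.const_mul _) i2, integral_const_mul, integral_const_mul,
        ih n (by omega), ih (n + 1) (by omega)] at this
      have := (mul_eq_zero.1 this).resolve_left I_ne_zero
      rw [hermiteVal_succ (n + 1), hermiteDer_succ]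
      linear_combination this

end HermiteIntegral

/-! ### Saddle-point estimates for the edge integrand -/

section EdgeIntegrand

open Complex

/-- In the application the exponent is multiplied by `N = e⁻³`: the terms `e - e²/2` must be exact
in order to cancel diverging factors, while `e³` costs only a constant. -/
theorem one_add_le_exp_of_le_one {e : ℝ} (h0 : 0 ≤ e) (h1 : e ≤ 1) :
    1 + e ≤ Real.exp (e - e ^ 2 / 2 + e ^ 3) := by
  have hu : 0 ≤ e - e ^ 2 / 2 + e ^ 3 := by nlinarith [pow_nonneg h0 3]
  refine le_trans ?_ (Real.quadratic_le_exp_of_nonneg hu)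
  have h3 := pow_nonneg h0 3
  nlinarith [pow_nonneg h0 4, pow_nonneg h0 5, pow_nonneg h0 6, mul_nonneg h3 (sub_nonneg.2 h1),
    mul_nonneg (pow_nonneg h0 4) (sub_nonneg.2 h1)]

/-- A Gaussian majorant uniform in `N`, for dominated convergence. With `e = q⁻²`, the squared
modulus of the base is `(1 + e)² (1 + e² τ² / (1 + e)²)`; both factors are bounded by exponentials,
and the diverging powers of `q` cancel. -/
theorem norm_edgeIntegrand_le {N : ℕ} {q : ℝ} (hq : 1 ≤ q) (hN : q ^ 6 = N) (τ : ℝ) :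
    ‖(1 + (1 + τ * I) / (q : ℂ) ^ 2) ^ N
        * cexp (-(q : ℂ) ^ 4 * (1 + τ * I) + (q : ℂ) ^ 2 * (1 + τ * I) ^ 2 / 2)‖
      ≤ Real.exp (1 - 3 / 8 * τ ^ 2) := by
  have hq0 : 0 < q := by linarith
  set e := 1 / q ^ 2 with he
  have he0 : 0 < e := by positivity
  have he1 : e ≤ 1 := by
    rw [he, div_le_one (by positivity)]; nlinarith
  have hqe : q ^ 2 = 1 / e := by rw [he]; field_simp
  set E := e - e ^ 2 / 2 + e ^ 3 + e ^ 2 * τ ^ 2 / (2 * (1 + e) ^ 2) with hE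
  have hnorm : ‖1 + (1 + τ * I) / (q : ℂ) ^ 2‖ ≤ Real.exp E := by
    have hz : (1 + (1 + τ * I) / (q : ℂ) ^ 2) = ((1 + e : ℝ) : ℂ) + ((e * τ : ℝ) : ℂ) * I := by
      rw [he]; push_cast; ring
    rw [← pow_le_pow_iff_left₀ (norm_nonneg _) (Real.exp_pos _).le two_ne_zero, Complex.sq_norm, hz,
      normSq_add_mul_I]
    have h1 := one_add_le_exp_of_le_one he0.le he1
    have h2 := Real.add_one_le_exp (e ^ 2 * τ ^ 2 / (1 + e) ^ 2)
    have h3 : Real.exp E ^ 2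
        = Real.exp (e - e ^ 2 / 2 + e ^ 3) ^ 2 * Real.exp (e ^ 2 * τ ^ 2 / (1 + e) ^ 2) := by
      rw [← Real.exp_nat_mul, ← Real.exp_nat_mul, ← Real.exp_add, hE]
      congr 1
      push_cast
      field_simp
    rw [h3]
    calc (1 + e) ^ 2 + (e * τ) ^ 2 = (1 + e) ^ 2 * (e ^ 2 * τ ^ 2 / (1 + e) ^ 2 + 1) := by
          field_simp
          ring
      _ ≤ _ := by gcongr
  have hre : (-(q : ℂ) ^ 4 * (1 + τ * I) + (q : ℂ) ^ 2 * (1 + τ * I) ^ 2 / 2).re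
      = -q ^ 4 + q ^ 2 * (1 - τ ^ 2) / 2 := by
    rw [show -(q : ℂ) ^ 4 * (1 + τ * I) + (q : ℂ) ^ 2 * (1 + τ * I) ^ 2 / 2
      = ((-q ^ 4 + q ^ 2 * (1 - τ ^ 2) / 2 : ℝ) : ℂ) + ((-q ^ 4 * τ + q ^ 2 * τ : ℝ) : ℂ) * I by
        push_cast; linear_combination (q : ℂ) ^ 2 * (τ : ℂ) ^ 2 / 2 * I_sq]
    rw [add_re, ofReal_re, re_ofReal_mul, I_re, mul_zero, add_zero]
  rw [norm_mul, norm_pow, norm_exp, hre]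
  calc ‖1 + (1 + τ * I) / (q : ℂ) ^ 2‖ ^ N * Real.exp (-q ^ 4 + q ^ 2 * (1 - τ ^ 2) / 2)
      ≤ Real.exp E ^ N * Real.exp (-q ^ 4 + q ^ 2 * (1 - τ ^ 2) / 2) := by gcongr
    _ = Real.exp (N * E + (-q ^ 4 + q ^ 2 * (1 - τ ^ 2) / 2)) := by
        rw [← Real.exp_nat_mul, ← Real.exp_add]
    _ ≤ _ := by
        refine Real.exp_le_exp.2 ?_
        rw [← hN, show q ^ 6 = (q ^ 2) ^ 3 by ring, show q ^ 4 = (q ^ 2) ^ 2 by ring, hqe]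
        have key : (1 / e) ^ 3 * E + (-(1 / e) ^ 2 + 1 / e * (1 - τ ^ 2) / 2)
            = 1 - (2 + e) / (2 * (1 + e) ^ 2) * τ ^ 2 := by
          rw [hE]; field_simp; ring
        rw [key]
        -- The right side decreases in `e` and equals `3 / 8` at `e = 1`.
        have : 3 / 8 ≤ (2 + e) / (2 * (1 + e) ^ 2) := by
          rw [le_div_iff₀ (by positivity)]
          nlinarith
        nlinarith [mul_le_mul_of_nonneg_right this (sq_nonneg τ)]

/-- `N ^ (1 / 6)`. -/
def edgeRoot (N : ℕ) : ℝ := (N : ℝ) ^ (1 / 6 : ℝ)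

theorem edgeRoot_pow_six (N : ℕ) : edgeRoot N ^ 6 = N := by
  rw [edgeRoot, ← Real.rpow_natCast, ← Real.rpow_mul (Nat.cast_nonneg N)]
  norm_num

theorem one_le_edgeRoot {N : ℕ} (hN : 1 ≤ N) : 1 ≤ edgeRoot N :=
  Real.one_le_rpow (by exact_mod_cast hN) (by norm_num)

theorem tendsto_edgeRoot : Tendsto edgeRoot atTop atTop :=
  (tendsto_rpow_atTop (by norm_num)).comp tendsto_natCast_atTop_atTop

/-- With `q = edgeRoot N`, `N log (1 + w / q²) = q⁴ w - q² w² / 2 + w³ / 3 + O(q⁻²)`. The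
exponential factor removes the first two terms. -/
theorem tendsto_edgeIntegrand (w : ℂ) :
    Tendsto (fun N : ℕ => (1 + w / (edgeRoot N : ℂ) ^ 2) ^ N
        * cexp (-(edgeRoot N : ℂ) ^ 4 * w + (edgeRoot N : ℂ) ^ 2 * w ^ 2 / 2))
      atTop (𝓝 (cexp (w ^ 3 / 3))) := by
  have hinv : Tendsto (fun N : ℕ => ‖w‖ ^ 4 / edgeRoot N ^ 2) atTop (𝓝 0) :=
    tendsto_const_nhds.div_atTop ((tendsto_pow_atTop two_ne_zero).comp tendsto_edgeRoot)
  have hsmall : ∀ᶠ N : ℕ in atTop, ‖w‖ / edgeRoot N ^ 2 ≤ 1 / 2 :=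
    (tendsto_const_nhds.div_atTop ((tendsto_pow_atTop two_ne_zero).comp
      tendsto_edgeRoot)).eventually_le_const (by norm_num)
  have hexpo : Tendsto (fun N : ℕ => (N : ℂ) * (log (1 + w / (edgeRoot N : ℂ) ^ 2)
      - logTaylor 4 (w / (edgeRoot N : ℂ) ^ 2))) atTop (𝓝 0) := by
    refine squeeze_zero_norm' ?_ hinv
    filter_upwards [hsmall, eventually_ge_atTop 1] with N hN hN1
    have hq := one_le_edgeRoot hN1
    have hq0 : 0 < edgeRoot N := by linarith
    have hz : ‖w / (edgeRoot N : ℂ) ^ 2‖ = ‖w‖ / edgeRoot N ^ 2 := by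
      rw [norm_div, norm_pow, norm_real, Real.norm_of_nonneg hq0.le]
    have h := norm_log_sub_logTaylor_le 3 (z := w / (edgeRoot N : ℂ) ^ 2) (by rw [hz]; linarith)
    rw [norm_mul, norm_natCast]
    rw [hz] at h
    have h2 : (1 - ‖w‖ / edgeRoot N ^ 2)⁻¹ ≤ 2 := by
      rw [inv_le_comm₀ (by linarith) (by norm_num)]; linarith
    calc (N : ℝ) * ‖log (1 + w / (edgeRoot N : ℂ) ^ 2) - logTaylor 4 (w / (edgeRoot N : ℂ) ^ 2)‖
        ≤ (N : ℝ) * ((‖w‖ / edgeRoot N ^ 2) ^ 4 * 2 / 2) := by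
          gcongr
          refine h.trans ?_
          push_cast
          gcongr
          norm_num
      _ = ‖w‖ ^ 4 / edgeRoot N ^ 2 := by
          rw [← edgeRoot_pow_six N]
          field_simp
  have hlim : Tendsto (fun N : ℕ => cexp ((N : ℂ) * (log (1 + w / (edgeRoot N : ℂ) ^ 2)
      - logTaylor 4 (w / (edgeRoot N : ℂ) ^ 2)) + w ^ 3 / 3)) atTop (𝓝 (cexp (w ^ 3 / 3))) := by
    have := (hexpo.add_const (w ^ 3 / 3)).cexp
    simpa using this
  refine hlim.congr' ?_
  filter_upwards [hsmall, eventually_ge_atTop 1] with N hN hN1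
  have hq := one_le_edgeRoot hN1
  have hq0 : (edgeRoot N : ℂ) ≠ 0 := ofReal_ne_zero.2 (by linarith)
  have hz : ‖w / (edgeRoot N : ℂ) ^ 2‖ ≤ 1 / 2 := by
    rwa [norm_div, norm_pow, norm_real, Real.norm_of_nonneg (by linarith)]
  have hne : 1 + w / (edgeRoot N : ℂ) ^ 2 ≠ 0 := by
    intro h
    rw [eq_neg_iff_add_eq_zero.2 ((add_comm _ _).trans h), norm_neg, norm_one] at hz
    norm_num at hz
  have hN' : (N : ℂ) = (edgeRoot N : ℂ) ^ 6 := by exact_mod_cast (edgeRoot_pow_six N).symm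
  have hpow : (1 + w / (edgeRoot N : ℂ) ^ 2) ^ N
      = cexp (N * log (1 + w / (edgeRoot N : ℂ) ^ 2)) := by
    rw [Complex.exp_nat_mul, Complex.exp_log hne]
  rw [hpow, ← Complex.exp_add]
  congr 1
  have ht : logTaylor 4 (w / (edgeRoot N : ℂ) ^ 2) = w / (edgeRoot N : ℂ) ^ 2
      - (w / (edgeRoot N : ℂ) ^ 2) ^ 2 / 2 + (w / (edgeRoot N : ℂ) ^ 2) ^ 3 / 3 := by
    simp [logTaylor, Finset.sum_range_succ]
    ring
  rw [ht, mul_sub]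
  have : (N : ℂ) * (w / (edgeRoot N : ℂ) ^ 2
      - (w / (edgeRoot N : ℂ) ^ 2) ^ 2 / 2 + (w / (edgeRoot N : ℂ) ^ 2) ^ 3 / 3)
      = (edgeRoot N : ℂ) ^ 4 * w - (edgeRoot N : ℂ) ^ 2 * w ^ 2 / 2 + w ^ 3 / 3 := by
    rw [hN']; field_simp
  rw [this]
  ring

end EdgeIntegrand

/-! ### Continuous convergence versus locally uniform convergence -/

section ContinuousConvergence

variable {X : Type*} [TopologicalSpace X] {E : Type*} [UniformSpace E]

/-- The limit of a continuously convergent sequence is continuous. -/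
theorem continuous_of_tendsto_prod_nhds {F : ℕ → X → E} {f : X → E}
    (h : ∀ x, Tendsto (fun p : ℕ × X => F p.1 p.2) (atTop ×ˢ 𝓝 x) (𝓝 (f x))) : Continuous f := by
  refine continuous_iff_continuousAt.2 fun x => ?_
  refine ((closed_nhds_basis (f x)).tendsto_right_iff).2 fun V hV => ?_
  obtain ⟨pa, ha, pb, hb, hab⟩ := eventually_prod_iff.1 ((h x).eventually hV.1)
  filter_upwards [hb] with y hy
  have hlim : Tendsto (fun n => F n y) atTop (𝓝 (f y)) :=
    (h y).comp (tendsto_id.prodMk tendsto_const_nhds)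
  exact hV.2.mem_of_tendsto hlim (ha.mono fun n hn => hab hn hy)

/-- Joint convergence makes the limit continuous, so near `x` both `F n y` and `f y` are close to `f
x`. Dominated convergence along a product filter can thus replace explicit uniform estimates. -/
theorem tendstoLocallyUniformly_of_tendsto_prod_nhds {F : ℕ → X → E} {f : X → E}
    (h : ∀ x, Tendsto (fun p : ℕ × X => F p.1 p.2) (atTop ×ˢ 𝓝 x) (𝓝 (f x))) :
    TendstoLocallyUniformly F f atTop := by
  rw [tendstoLocallyUniformly_iff_forall_tendsto]
  intro x
  have hc := (continuous_of_tendsto_prod_nhds h).continuousAt (x := x)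
  have h1 : Tendsto (fun p : ℕ × X => f p.2) (atTop ×ˢ 𝓝 x) (𝓝 (f x)) := hc.tendsto.comp tendsto_snd
  exact (Uniform.tendsto_nhds_left.1 h1).uniformity_trans (Uniform.tendsto_nhds_right.1 (h x))

theorem TendstoLocallyUniformly.tendsto_prod_nhds {F : ℕ → X → E} {f : X → E}
    (h : TendstoLocallyUniformly F f atTop) (hf : Continuous f) (x : X) :
    Tendsto (fun p : ℕ × X => F p.1 p.2) (atTop ×ˢ 𝓝 x) (𝓝 (f x)) := by
  have h1 : Tendsto (fun p : ℕ × X => f p.2) (atTop ×ˢ 𝓝 x) (𝓝 (f x)) :=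
    hf.continuousAt.tendsto.comp tendsto_snd
  exact Uniform.tendsto_nhds_right.2 ((Uniform.tendsto_nhds_right.1 h1).uniformity_trans
    (tendstoLocallyUniformly_iff_forall_tendsto.1 h x))

end ContinuousConvergence

/-! ### Convergence to the Airy function -/

section Airy

open Complex

/-- The complex Airy function. -/
def airyC (s : ℂ) : ℂ :=
  (1 / (2 * Real.pi : ℝ) : ℂ) * ∫ t : ℝ, cexp ((1 + t * I) ^ 3 / 3 - s * (1 + t * I))

/-- The normalization of the Hermite polynomials at the edge. -/
def edgeKappa (N : ℕ) : ℝ :=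
  Real.sqrt (2 * Real.pi) * edgeRoot N * edgeRoot N ^ (3 * N) * Real.exp (edgeRoot N ^ 6 / 2)

/-- The edge scaling with a complex argument. -/
def edgeArg (N : ℕ) (s : ℂ) : ℂ := 2 * (edgeRoot N : ℂ) ^ 3 + s / edgeRoot N

/-- The normalized Hermite polynomial at the edge. -/
def hermiteEdge (N : ℕ) (s : ℂ) : ℂ :=
  (edgeKappa N : ℂ)⁻¹ * (cexp (-(edgeRoot N : ℂ) ^ 2 * s) * hermiteVal N (edgeArg N s))

/-- The derivative of `hermiteEdge`. -/
def hermiteEdgeDer (N : ℕ) (s : ℂ) : ℂ :=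
  (edgeKappa N : ℂ)⁻¹ * (cexp (-(edgeRoot N : ℂ) ^ 2 * s)
    * (hermiteDer N (edgeArg N s) / edgeRoot N - (edgeRoot N : ℂ) ^ 2 * hermiteVal N (edgeArg N s)))

/-- At the argument `2 √N` the phase `N log z + (z - 2 √N)² / 2` has a double critical point at `z =
√N = q³`. The integral is taken on the line `z = q³ + q (1 + i τ)`, whose offset `q` produces the
line `1 + i τ` of the Airy integral. -/
theorem hermiteEdge_eq_integral {N : ℕ} (hN : 1 ≤ N) (s : ℂ) :
    hermiteEdge N s = (1 / (2 * Real.pi : ℝ) : ℂ) * (cexp (s ^ 2 / (2 * (edgeRoot N : ℂ) ^ 2))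
      * ∫ τ : ℝ, (1 + (1 + τ * I) / (edgeRoot N : ℂ) ^ 2) ^ N
        * cexp (-(edgeRoot N : ℂ) ^ 4 * (1 + τ * I) + (edgeRoot N : ℂ) ^ 2 * (1 + τ * I) ^ 2 / 2)
        * cexp (-s * (1 + τ * I))) := by
  have hq := one_le_edgeRoot hN
  set q := edgeRoot N with hq_def
  have hq0 : 0 < q := by linarith
  have hqC : (q : ℂ) ≠ 0 := ofReal_ne_zero.2 hq0.ne'
  have h1 := integral_pow_mul_cexp_sq N (q ^ 3 + q) (edgeArg N s)
  have h2 := Measure.integral_comp_mul_left (fun t : ℝ => (((q ^ 3 + q : ℝ) : ℂ) + t * I) ^ N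
    * cexp ((((q ^ 3 + q : ℝ) : ℂ) + t * I - edgeArg N s) ^ 2 / 2)) q
  rw [h1, abs_of_pos (inv_pos.2 hq0), real_smul] at h2
  have h3 : ∀ τ : ℝ, (((q ^ 3 + q : ℝ) : ℂ) + ((q * τ : ℝ) : ℂ) * I) ^ N
      * cexp ((((q ^ 3 + q : ℝ) : ℂ) + ((q * τ : ℝ) : ℂ) * I - edgeArg N s) ^ 2 / 2)
      = ((q : ℂ) ^ (3 * N) * cexp ((q : ℂ) ^ 6 / 2) * cexp ((q : ℂ) ^ 2 * s)
          * cexp (s ^ 2 / (2 * (q : ℂ) ^ 2)))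
        * ((1 + (1 + τ * I) / (q : ℂ) ^ 2) ^ N
        * cexp (-(q : ℂ) ^ 4 * (1 + τ * I) + (q : ℂ) ^ 2 * (1 + τ * I) ^ 2 / 2)
        * cexp (-s * (1 + τ * I))) := by
    intro τ
    have e1 : (((q ^ 3 + q : ℝ) : ℂ) + ((q * τ : ℝ) : ℂ) * I)
        = (q : ℂ) ^ 3 * (1 + (1 + τ * I) / (q : ℂ) ^ 2) := by
      push_cast; field_simp; ring
    rw [e1, mul_pow, ← pow_mul]
    have e2 : cexp (((q : ℂ) ^ 3 * (1 + (1 + τ * I) / (q : ℂ) ^ 2) - edgeArg N s) ^ 2 / 2)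
        = cexp ((q : ℂ) ^ 6 / 2) * cexp ((q : ℂ) ^ 2 * s) * cexp (s ^ 2 / (2 * (q : ℂ) ^ 2))
        * cexp (-(q : ℂ) ^ 4 * (1 + τ * I) + (q : ℂ) ^ 2 * (1 + τ * I) ^ 2 / 2)
        * cexp (-s * (1 + τ * I)) := by
      simp only [← Complex.exp_add]
      congr 1
      rw [edgeArg, ← hq_def]
      field_simp
      ring
    rw [e2]
    ring
  simp only [h3] at h2
  rw [integral_const_mul] at h2
  set J := ∫ τ : ℝ, (1 + (1 + τ * I) / (q : ℂ) ^ 2) ^ N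
        * cexp (-(q : ℂ) ^ 4 * (1 + τ * I) + (q : ℂ) ^ 2 * (1 + τ * I) ^ 2 / 2)
        * cexp (-s * (1 + τ * I))
  have hpi : (Real.sqrt (2 * Real.pi) : ℂ) * Real.sqrt (2 * Real.pi) = (2 * Real.pi : ℝ) := by
    exact_mod_cast Real.mul_self_sqrt (by positivity)
  have hpi0 : (Real.sqrt (2 * Real.pi) : ℂ) ≠ 0 := ofReal_ne_zero.2 (by positivity)
  have hval : hermiteVal N (edgeArg N s) = q * ((q : ℂ) ^ (3 * N) * cexp ((q : ℂ) ^ 6 / 2)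
      * cexp ((q : ℂ) ^ 2 * s) * cexp (s ^ 2 / (2 * (q : ℂ) ^ 2))) * J
        / Real.sqrt (2 * Real.pi) := by
    rw [eq_div_iff hpi0, mul_assoc (q : ℂ), h2]
    push_cast
    field_simp
  have he : cexp (-((q : ℂ) ^ 2 * s)) * cexp ((q : ℂ) ^ 2 * s) = 1 := by
    rw [← Complex.exp_add, neg_add_cancel, Complex.exp_zero]
  have hx : cexp ((q : ℂ) ^ 6 / 2) ≠ 0 := Complex.exp_ne_zero _
  rw [hermiteEdge, hval, edgeKappa, ← hq_def, ← hpi]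
  push_cast
  field_simp
  linear_combination J * he

/-- Dominated convergence in the contour integral, with `N → ∞` and `s → s₀` together; the prefactor
`exp (s² / (2 q²))` tends to `1`. -/
theorem tendsto_hermiteEdge (s₀ : ℂ) :
    Tendsto (fun p : ℕ × ℂ => hermiteEdge p.1 p.2) (atTop ×ˢ 𝓝 s₀) (𝓝 (airyC s₀)) := by
  have hint : Tendsto (fun p : ℕ × ℂ => ∫ τ : ℝ, (1 + (1 + τ * I) / (edgeRoot p.1 : ℂ) ^ 2) ^ p.1
        * cexp (-(edgeRoot p.1 : ℂ) ^ 4 * (1 + τ * I)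
          + (edgeRoot p.1 : ℂ) ^ 2 * (1 + τ * I) ^ 2 / 2)
        * cexp (-p.2 * (1 + τ * I))) (atTop ×ˢ 𝓝 s₀)
      (𝓝 (∫ t : ℝ, cexp ((1 + t * I) ^ 3 / 3 - s₀ * (1 + t * I)))) := by
    have hbd : Integrable fun τ : ℝ => Real.exp (1 + (‖s₀‖ + 1))
        * Real.exp (-(3 / 8) * τ ^ 2 + (‖s₀‖ + 1) * |τ|) :=
      (integrable_exp_neg_mul_sq_add_mul_abs (by norm_num) _).const_mul _
    refine tendsto_integral_filter_of_dominated_convergence _ ?_ ?_ hbd ?_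
    · refine Eventually.of_forall fun p => Continuous.aestronglyMeasurable ?_
      fun_prop
    · have h1 : ∀ᶠ p : ℕ × ℂ in atTop ×ˢ 𝓝 s₀, 1 ≤ p.1 := tendsto_fst.eventually_ge_atTop 1
      have h2 : ∀ᶠ p : ℕ × ℂ in atTop ×ˢ 𝓝 s₀, p.2 ∈ Metric.ball s₀ 1 :=
        tendsto_snd.eventually (Metric.ball_mem_nhds s₀ one_pos)
      filter_upwards [h1, h2] with p hp1 hp2
      refine ae_of_all _ fun τ => ?_
      rw [norm_mul, norm_exp (-p.2 * (1 + τ * I))]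
      have hA := norm_edgeIntegrand_le (one_le_edgeRoot hp1) (edgeRoot_pow_six p.1) τ
      have hs : ‖p.2‖ ≤ ‖s₀‖ + 1 := by
        have := norm_sub_norm_le p.2 s₀
        rw [Metric.mem_ball, dist_eq_norm] at hp2
        linarith
      have hB : (-p.2 * (1 + τ * I)).re ≤ (‖s₀‖ + 1) * (1 + |τ|) := by
        refine (re_le_norm _).trans ?_
        rw [norm_mul, norm_neg]
        have : ‖(1 : ℂ) + τ * I‖ ≤ 1 + |τ| := (norm_add_le _ _).trans (by simp)
        gcongr
      calc _ ≤ Real.exp (1 - 3 / 8 * τ ^ 2) * Real.exp ((‖s₀‖ + 1) * (1 + |τ|)) := by gcongr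
        _ = _ := by
          rw [← Real.exp_add, ← Real.exp_add]
          congr 1
          ring
    · refine ae_of_all _ fun τ => ?_
      have h1 := (tendsto_edgeIntegrand (1 + τ * I)).comp
        (tendsto_fst : Tendsto (Prod.fst : ℕ × ℂ → ℕ) (atTop ×ˢ 𝓝 s₀) atTop)
      have h2 : Tendsto (fun p : ℕ × ℂ => cexp (-p.2 * (1 + τ * I))) (atTop ×ˢ 𝓝 s₀)
          (𝓝 (cexp (-s₀ * (1 + τ * I)))) :=
        ((tendsto_snd (f := atTop) (g := 𝓝 s₀)).neg.mul_const (1 + τ * I)).cexp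
      have := h1.mul h2
      rw [← Complex.exp_add] at this
      rwa [show (1 + (τ : ℂ) * I) ^ 3 / 3 - s₀ * (1 + τ * I)
        = (1 + (τ : ℂ) * I) ^ 3 / 3 + -s₀ * (1 + τ * I) by ring]
  have hpre : Tendsto (fun p : ℕ × ℂ => cexp (p.2 ^ 2 / (2 * (edgeRoot p.1 : ℂ) ^ 2)))
      (atTop ×ˢ 𝓝 s₀) (𝓝 1) := by
    have hinv : Tendsto (fun N : ℕ => ((edgeRoot N : ℂ))⁻¹) atTop (𝓝 0) := by
      have := (continuous_ofReal.tendsto 0).comp (tendsto_inv_atTop_zero.comp tendsto_edgeRoot)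
      simpa [Function.comp_def] using this
    have h1 : Tendsto (fun p : ℕ × ℂ => p.2 ^ 2 * (((edgeRoot p.1 : ℂ))⁻¹ ^ 2 / 2))
        (atTop ×ˢ 𝓝 s₀) (𝓝 (s₀ ^ 2 * (0 ^ 2 / 2))) :=
      ((tendsto_snd (f := atTop) (g := 𝓝 s₀)).pow 2).mul
        (((hinv.comp tendsto_fst).pow 2).div_const 2)
    have h2 := h1.cexp
    rw [show s₀ ^ 2 * (0 ^ 2 / 2) = 0 by ring, Complex.exp_zero] at h2
    refine h2.congr fun p => ?_
    congr 1
    rw [inv_pow]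
    field_simp
  have := (hpre.mul hint).const_mul (1 / (2 * Real.pi : ℝ) : ℂ)
  rw [one_mul] at this
  refine this.congr' ?_
  filter_upwards [(tendsto_fst.eventually_ge_atTop 1 : ∀ᶠ p : ℕ × ℂ in atTop ×ˢ 𝓝 s₀, 1 ≤ p.1)]
    with p hp
  exact (hermiteEdge_eq_integral hp p.2).symm

theorem hasDerivAt_edgeArg (N : ℕ) (s : ℂ) : HasDerivAt (edgeArg N) (1 / edgeRoot N) s :=
  ((hasDerivAt_id s).div_const _).const_add _

theorem hasDerivAt_hermiteEdge (N : ℕ) (s : ℂ) :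
    HasDerivAt (hermiteEdge N) (hermiteEdgeDer N s) s := by
  have h1 := (hasDerivAt_hermiteVal N (edgeArg N s)).comp s (hasDerivAt_edgeArg N s)
  have h2 := ((hasDerivAt_id s).const_mul (-(edgeRoot N : ℂ) ^ 2)).cexp
  refine ((h2.mul h1).const_mul (edgeKappa N : ℂ)⁻¹).congr_deriv ?_
  simp only [hermiteEdgeDer, id, Function.comp]
  ring

/-- Hermite's equation in edge coordinates. The exponential factor is tuned so that all growing
powers of `edgeRoot N` cancel, leaving a perturbation of Airy's equation. -/
theorem hasDerivAt_hermiteEdgeDer {N : ℕ} (hN : 1 ≤ N) (s : ℂ) :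
    HasDerivAt (hermiteEdgeDer N)
      (s * hermiteEdge N s + s / (edgeRoot N : ℂ) ^ 2 * hermiteEdgeDer N s) s := by
  have hq0 : (edgeRoot N : ℂ) ≠ 0 := ofReal_ne_zero.2 (by have := one_le_edgeRoot hN; linarith)
  have hN' : (N : ℂ) = (edgeRoot N : ℂ) ^ 6 := by exact_mod_cast (edgeRoot_pow_six N).symm
  have h1 := (hasDerivAt_hermiteVal N (edgeArg N s)).comp s (hasDerivAt_edgeArg N s)
  have h1' := (hasDerivAt_hermiteDer N (edgeArg N s)).comp s (hasDerivAt_edgeArg N s)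
  have h2 := ((hasDerivAt_id s).const_mul (-(edgeRoot N : ℂ) ^ 2)).cexp
  refine ((h2.mul ((h1'.div_const (edgeRoot N : ℂ)).sub
    (h1.const_mul ((edgeRoot N : ℂ) ^ 2)))).const_mul (edgeKappa N : ℂ)⁻¹).congr_deriv ?_
  simp only [hermiteEdgeDer, hermiteEdge, id, Function.comp, Pi.sub_apply, hN']
  generalize (edgeKappa N : ℂ)⁻¹ = k
  generalize cexp (-(edgeRoot N : ℂ) ^ 2 * s) = e
  generalize hermiteVal N (edgeArg N s) = a
  generalize hermiteDer N (edgeArg N s) = b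
  rw [edgeArg]
  generalize (edgeRoot N : ℂ) = q at *
  field_simp
  ring

theorem continuous_airyC : Continuous airyC :=
  continuous_of_tendsto_prod_nhds tendsto_hermiteEdge

theorem tendstoLocallyUniformlyOn_hermiteEdge :
    TendstoLocallyUniformlyOn hermiteEdge airyC atTop Set.univ :=
  (tendstoLocallyUniformly_of_tendsto_prod_nhds tendsto_hermiteEdge).tendstoLocallyUniformlyOn

theorem differentiable_hermiteEdge (N : ℕ) : Differentiable ℂ (hermiteEdge N) := fun s =>
  (hasDerivAt_hermiteEdge N s).differentiableAt

theorem differentiable_airyC : Differentiable ℂ airyC :=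
  differentiableOn_univ.1 (tendstoLocallyUniformlyOn_hermiteEdge.differentiableOn
    (Eventually.of_forall fun N => (differentiable_hermiteEdge N).differentiableOn) isOpen_univ)

/-- Weierstrass's theorem: locally uniform limits of holomorphic functions may be differentiated.
This is what complex arguments provide. -/
theorem tendstoLocallyUniformlyOn_hermiteEdgeDer :
    TendstoLocallyUniformlyOn hermiteEdgeDer (deriv airyC) atTop Set.univ := by
  have := tendstoLocallyUniformlyOn_hermiteEdge.deriv
    (Eventually.of_forall fun N => (differentiable_hermiteEdge N).differentiableOn) isOpen_univ
  convert this using 1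
  ext N s
  exact (hasDerivAt_hermiteEdge N s).deriv.symm

theorem differentiable_deriv_airyC : Differentiable ℂ (deriv airyC) :=
  differentiable_airyC.deriv

theorem tendsto_hermiteEdgeDer (s₀ : ℂ) :
    Tendsto (fun p : ℕ × ℂ => hermiteEdgeDer p.1 p.2) (atTop ×ˢ 𝓝 s₀) (𝓝 (deriv airyC s₀)) :=
  (tendstoLocallyUniformlyOn_univ.1 tendstoLocallyUniformlyOn_hermiteEdgeDer).tendsto_prod_nhds
    differentiable_deriv_airyC.continuous s₀

theorem tendsto_inv_edgeRoot : Tendsto (fun N : ℕ => ((edgeRoot N : ℂ))⁻¹) atTop (𝓝 0) := by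
  have := (continuous_ofReal.tendsto 0).comp (tendsto_inv_atTop_zero.comp tendsto_edgeRoot)
  simpa [Function.comp_def] using this

theorem tendsto_hermiteEdge_ode (s₀ : ℂ) :
    Tendsto (fun p : ℕ × ℂ => p.2 * hermiteEdge p.1 p.2
      + p.2 / (edgeRoot p.1 : ℂ) ^ 2 * hermiteEdgeDer p.1 p.2) (atTop ×ˢ 𝓝 s₀)
      (𝓝 (s₀ * airyC s₀)) := by
  have h2 : Tendsto (fun p : ℕ × ℂ => p.2) (atTop ×ˢ 𝓝 s₀) (𝓝 s₀) := tendsto_snd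
  have h3 : Tendsto (fun p : ℕ × ℂ => p.2 / (edgeRoot p.1 : ℂ) ^ 2) (atTop ×ˢ 𝓝 s₀) (𝓝 0) := by
    have := h2.mul ((tendsto_inv_edgeRoot.comp
      (tendsto_fst (f := atTop) (g := 𝓝 s₀))).pow 2)
    simpa [div_eq_mul_inv] using this
  simpa using (h2.mul (tendsto_hermiteEdge s₀)).add (h3.mul (tendsto_hermiteEdgeDer s₀))

/-- The Airy differential equation. -/
theorem deriv_deriv_airyC (s : ℂ) : deriv (deriv airyC) s = s * airyC s := by
  have hd : ∀ᶠ N : ℕ in atTop, DifferentiableOn ℂ (hermiteEdgeDer N) Set.univ := by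
    filter_upwards [eventually_ge_atTop 1] with N hN s _
    exact (hasDerivAt_hermiteEdgeDer hN s).differentiableAt.differentiableWithinAt
  have h1 := (tendstoLocallyUniformlyOn_hermiteEdgeDer.deriv hd isOpen_univ).tendsto_at
    (Set.mem_univ s)
  have hs : Tendsto (fun N : ℕ => (N, s)) atTop (atTop ×ˢ 𝓝 s) :=
    tendsto_id.prodMk tendsto_const_nhds
  -- The second derivatives of `hermiteEdge N` have two limits, one from Weierstrass's theorem and
  -- one from Hermite's equation.
  refine tendsto_nhds_unique h1 (((tendsto_hermiteEdge_ode s).comp hs).congr' ?_)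
  filter_upwards [eventually_ge_atTop 1] with N hN
  exact (hasDerivAt_hermiteEdgeDer hN s).deriv.symm

theorem hasDerivAt_airyC (s : ℂ) : HasDerivAt airyC (deriv airyC s) s :=
  (differentiable_airyC s).hasDerivAt

theorem hasDerivAt_deriv_airyC (s : ℂ) : HasDerivAt (deriv airyC) (s * airyC s) s :=
  deriv_deriv_airyC s ▸ (differentiable_deriv_airyC s).hasDerivAt

theorem edgeArg_ofReal (N : ℕ) (s : ℝ) :
    edgeArg N s = ((2 * edgeRoot N ^ 3 + s / edgeRoot N : ℝ) : ℂ) := by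
  simp [edgeArg]

/-- The real parts agree by definition; the imaginary part vanishes because `hermiteEdge N x` is
real and converges to `airyC x`. -/
theorem airyC_ofReal (x : ℝ) : airyC x = airyAi x := by
  have hre : (airyC x).re = airyAi x := by
    rw [airyC, airyAi, ← ofReal_one, ← ofReal_div, re_ofReal_mul]
  have him : (airyC x).im = 0 := by
    have hs : Tendsto (fun N : ℕ => (N, (x : ℂ))) atTop (atTop ×ˢ 𝓝 (x : ℂ)) :=
      tendsto_id.prodMk tendsto_const_nhds
    have h := (continuous_im.tendsto _).comp ((tendsto_hermiteEdge x).comp hs)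
    refine tendsto_nhds_unique h (tendsto_const_nhds.congr fun N => ?_)
    have : hermiteEdge N x = (((edgeKappa N)⁻¹ * (Real.exp (-edgeRoot N ^ 2 * x)
        * hermiteVal N (2 * edgeRoot N ^ 3 + x / edgeRoot N)) : ℝ) : ℂ) := by
      rw [hermiteEdge, edgeArg_ofReal, hermiteVal_ofReal]
      push_cast
      rfl
    simp only [Function.comp, this, ofReal_im]
  rw [← hre]
  exact Complex.ext (by simp) (by simp [him])

theorem hasDerivAt_airyAi_aux (x : ℝ) : HasDerivAt airyAi (deriv airyC x).re x := by
  have := (hasDerivAt_airyC x).real_of_complex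
  refine this.congr_of_eventuallyEq (Eventually.of_forall fun y => ?_)
  simp [airyC_ofReal]

theorem deriv_airyC_ofReal (x : ℝ) : deriv airyC x = airyAiDeriv x := by
  have h1 := (hasDerivAt_airyC x).comp_ofReal
  have h2 := (hasDerivAt_airyAi_aux x).ofReal_comp
  rw [show (fun y : ℝ => airyC y) = fun y : ℝ => (airyAi y : ℂ) from funext airyC_ofReal] at h1
  rw [h1.unique h2, airyAiDeriv, (hasDerivAt_airyAi_aux x).deriv]

theorem hasDerivAt_airyAi (x : ℝ) : HasDerivAt airyAi (airyAiDeriv x) x :=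
  (hasDerivAt_airyAi_aux x).differentiableAt.hasDerivAt

theorem hasDerivAt_airyAiDeriv (x : ℝ) : HasDerivAt airyAiDeriv (x * airyAi x) x := by
  have := (hasDerivAt_deriv_airyC x).real_of_complex
  rw [airyC_ofReal, re_ofReal_mul, ofReal_re] at this
  refine this.congr_of_eventuallyEq (Eventually.of_forall fun y => ?_)
  simp [deriv_airyC_ofReal]

end Airy

/-! ### The limit of the iterated Christoffel–Darboux sums -/

section KernelLimit

open Complex

/-- The kernel `𝔹` with complex arguments, away from the diagonal. -/
def airyKernelTwoC (s t : ℂ) : ℂ :=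
  (s * airyC s * airyC t + airyC s * (t * airyC t) - 2 * deriv airyC s * deriv airyC t)
      / (s - t) ^ 2
    + 2 * (airyC s * deriv airyC t - deriv airyC s * airyC t) / (s - t) ^ 3

/-- The normalized iterated Christoffel–Darboux sum at the edge. -/
def edgeSumTwo (N : ℕ) (p : ℂ × ℂ) : ℂ :=
  N.factorial * ((edgeKappa N : ℂ)⁻¹ ^ 2 / (edgeRoot N : ℂ) ^ 4)
    * (cexp (-(edgeRoot N : ℂ) ^ 2 * p.1) * cexp (-(edgeRoot N : ℂ) ^ 2 * p.2))
    * hermiteSumTwo N (edgeArg N p.1) (edgeArg N p.2)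

/-- Rescaling of `factorial_mul_hermiteSumTwo`. With `h = hermiteEdge N`, the numerators are `(∂_s -
∂_t)²` and `-2 (∂_s - ∂_t)` applied to `h(s) h(t)`; the exponential prefactor depends only on `s +
t` and passes through these operators. -/
theorem edgeSumTwo_eq {N : ℕ} (hN : 1 ≤ N) {s t : ℂ} (hst : s ≠ t) :
    edgeSumTwo N (s, t)
      = ((s * hermiteEdge N s + s / (edgeRoot N : ℂ) ^ 2 * hermiteEdgeDer N s) * hermiteEdge N t
          + hermiteEdge N s
            * (t * hermiteEdge N t + t / (edgeRoot N : ℂ) ^ 2 * hermiteEdgeDer N t)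
          - 2 * hermiteEdgeDer N s * hermiteEdgeDer N t) / (s - t) ^ 2
        + 2 * (hermiteEdge N s * hermiteEdgeDer N t - hermiteEdgeDer N s * hermiteEdge N t)
          / (s - t) ^ 3 := by
  have hq0 : (edgeRoot N : ℂ) ≠ 0 := ofReal_ne_zero.2 (by have := one_le_edgeRoot hN; linarith)
  have hN' : (N : ℂ) = (edgeRoot N : ℂ) ^ 6 := by exact_mod_cast (edgeRoot_pow_six N).symm
  have hid := factorial_mul_hermiteSumTwo N (edgeArg N s) (edgeArg N t)
  have hst' := sub_ne_zero.2 hst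
  rw [div_add_div _ _ (pow_ne_zero _ hst') (pow_ne_zero _ hst'),
    eq_div_iff (mul_ne_zero (pow_ne_zero _ hst') (pow_ne_zero _ hst'))]
  simp only [edgeSumTwo, hermiteEdge, hermiteEdgeDer]
  rw [hN'] at hid
  have hs : s = edgeRoot N * (edgeArg N s - 2 * (edgeRoot N : ℂ) ^ 3) := by
    rw [edgeArg]; field_simp; ring
  have ht : t = edgeRoot N * (edgeArg N t - 2 * (edgeRoot N : ℂ) ^ 3) := by
    rw [edgeArg]; field_simp; ring
  generalize cexp (-(edgeRoot N : ℂ) ^ 2 * s) = e₁ at *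
  generalize cexp (-(edgeRoot N : ℂ) ^ 2 * t) = e₂ at *
  generalize hermiteVal N (edgeArg N s) = a at *
  generalize hermiteVal N (edgeArg N t) = b at *
  generalize hermiteDer N (edgeArg N s) = a' at *
  generalize hermiteDer N (edgeArg N t) = b' at *
  generalize hermiteSumTwo N (edgeArg N s) (edgeArg N t) = S at *
  generalize (edgeKappa N : ℂ)⁻¹ = k at *
  generalize (N.factorial : ℂ) = f at *
  generalize edgeArg N s = x at *
  generalize edgeArg N t = y at *
  generalize (edgeRoot N : ℂ) = q at *
  subst hs ht
  field_simp
  linear_combination k ^ 2 * e₁ * e₂ * (x - y) ^ 2 * hid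

theorem tendsto_edgeSumTwo_of_ne {s₀ t₀ : ℂ} (h : s₀ ≠ t₀) :
    Tendsto (fun p : ℕ × ℂ × ℂ => edgeSumTwo p.1 p.2) (atTop ×ˢ 𝓝 (s₀, t₀))
      (𝓝 (airyKernelTwoC s₀ t₀)) := by
  have hfst : Tendsto (fun p : ℕ × ℂ × ℂ => p.2.1) (atTop ×ˢ 𝓝 (s₀, t₀)) (𝓝 s₀) :=
    (continuous_fst.tendsto (s₀, t₀)).comp tendsto_snd
  have hsnd : Tendsto (fun p : ℕ × ℂ × ℂ => p.2.2) (atTop ×ˢ 𝓝 (s₀, t₀)) (𝓝 t₀) :=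
    (continuous_snd.tendsto (s₀, t₀)).comp tendsto_snd
  have h1 : Tendsto (fun p : ℕ × ℂ × ℂ => (p.1, p.2.1)) (atTop ×ˢ 𝓝 (s₀, t₀)) (atTop ×ˢ 𝓝 s₀) :=
    tendsto_fst.prodMk hfst
  have h2 : Tendsto (fun p : ℕ × ℂ × ℂ => (p.1, p.2.2)) (atTop ×ˢ 𝓝 (s₀, t₀)) (atTop ×ˢ 𝓝 t₀) :=
    tendsto_fst.prodMk hsnd
  have hsub := hfst.sub hsnd
  have hne := sub_ne_zero.2 h
  have u := (tendsto_hermiteEdge s₀).comp h1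
  have v := (tendsto_hermiteEdge t₀).comp h2
  have u' := (tendsto_hermiteEdgeDer s₀).comp h1
  have v' := (tendsto_hermiteEdgeDer t₀).comp h2
  have u'' := (tendsto_hermiteEdge_ode s₀).comp h1
  have v'' := (tendsto_hermiteEdge_ode t₀).comp h2
  have hlim := (((((u''.mul v).add (u.mul v'')).sub ((u'.const_mul 2).mul v')).div
    (hsub.pow 2) (pow_ne_zero 2 hne)).add ((((u.mul v').sub (u'.mul v)).const_mul 2).div
    (hsub.pow 3) (pow_ne_zero 3 hne)))
  refine hlim.congr' ?_
  have hneq : ∀ᶠ p : ℕ × ℂ × ℂ in atTop ×ˢ 𝓝 (s₀, t₀), p.2.1 ≠ p.2.2 :=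
    (hsub.eventually_ne hne).mono fun p hp => sub_ne_zero.1 hp
  filter_upwards [hneq, (tendsto_fst.eventually_ge_atTop 1 :
    ∀ᶠ p : ℕ × ℂ × ℂ in atTop ×ˢ 𝓝 (s₀, t₀), 1 ≤ p.1)] with p hp hp1
  exact (edgeSumTwo_eq hp1 hp).symm

theorem continuousAt_airyKernelTwoC {s₀ t₀ : ℂ} (h : s₀ ≠ t₀) :
    ContinuousAt (fun p : ℂ × ℂ => airyKernelTwoC p.1 p.2) (s₀, t₀) := by
  have hne := sub_ne_zero.2 h
  have hA := continuous_airyC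
  have hA' := differentiable_deriv_airyC.continuous
  unfold airyKernelTwoC
  refine ContinuousAt.add (ContinuousAt.div ?_ ?_ (pow_ne_zero 2 hne))
    (ContinuousAt.div ?_ ?_ (pow_ne_zero 3 hne)) <;>
  exact Continuous.continuousAt (by fun_prop)

theorem isOpen_offDiagonal : IsOpen {p : ℂ × ℂ | p.1 ≠ p.2} :=
  isOpen_ne_fun continuous_fst continuous_snd

theorem tendstoLocallyUniformlyOn_edgeSumTwo :
    TendstoLocallyUniformlyOn edgeSumTwo (fun p => airyKernelTwoC p.1 p.2) atTop
      {p : ℂ × ℂ | p.1 ≠ p.2} := by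
  rw [isOpen_offDiagonal.tendstoLocallyUniformlyOn_iff_forall_tendsto]
  intro p hp
  have h1 : Tendsto (fun y : ℕ × ℂ × ℂ => airyKernelTwoC y.2.1 y.2.2) (atTop ×ˢ 𝓝 p)
      (𝓝 (airyKernelTwoC p.1 p.2)) := (continuousAt_airyKernelTwoC hp).tendsto.comp tendsto_snd
  exact (Uniform.tendsto_nhds_left.1 h1).uniformity_trans
    (Uniform.tendsto_nhds_right.1 (tendsto_edgeSumTwo_of_ne hp))

theorem differentiable_hermiteSumTwo_left (N : ℕ) (y : ℂ) :
    Differentiable ℂ fun x => hermiteSumTwo N x y := by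
  unfold hermiteSumTwo hermiteSum hermiteProd
  refine Differentiable.fun_sum fun m _ => Differentiable.fun_sum fun j _ => ?_
  have : Differentiable ℂ (hermiteVal j : ℂ → ℂ) := fun x =>
    (hasDerivAt_hermiteVal j x).differentiableAt
  fun_prop

theorem differentiable_edgeSumTwo_left (N : ℕ) (t : ℂ) :
    Differentiable ℂ fun s => edgeSumTwo N (s, t) := by
  have h1 := differentiable_hermiteSumTwo_left N (edgeArg N t)
  have h2 : Differentiable ℂ (edgeArg N) := fun s => (hasDerivAt_edgeArg N s).differentiableAt
  have h3 : Differentiable ℂ fun s => hermiteSumTwo N (edgeArg N s) (edgeArg N t) := h1.comp h2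
  unfold edgeSumTwo
  exact Differentiable.mul (by fun_prop) h3

theorem continuous_hermiteVal (j : ℕ) : Continuous (hermiteVal j : ℂ → ℂ) :=
  continuous_iff_continuousAt.2 fun x => (hasDerivAt_hermiteVal j x).continuousAt

theorem continuous_edgeSumTwo (N : ℕ) : Continuous (edgeSumTwo N) := by
  have h := continuous_hermiteVal
  unfold edgeSumTwo hermiteSumTwo hermiteSum hermiteProd edgeArg
  refine Continuous.mul (by fun_prop) (continuous_finsetSum _ fun m _ =>
    continuous_finsetSum _ fun j _ => ?_)
  have := h j
  fun_prop

/-- The explicit formula is useless near the diagonal, but the sums are entire in `s`. On a large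
circle in `s`, away from all `t` under consideration, they converge uniformly, and the maximum
principle bounds their differences inside. -/
theorem uniformCauchySeqOn_edgeSumTwo (s₀ t₀ : ℂ) :
    UniformCauchySeqOn edgeSumTwo atTop
      (Metric.closedBall s₀ (‖s₀ - t₀‖ + 1) ×ˢ Metric.closedBall t₀ (1 / 2)) := by
  set R := ‖s₀ - t₀‖ + 1 with hR
  have hR0 : 0 < R := by positivity
  have hK : IsCompact (Metric.sphere s₀ R ×ˢ Metric.closedBall t₀ (1 / 2)) :=
    (isCompact_sphere _ _).prod (isCompact_closedBall _ _)
  -- By the choice of `R`, points of the circle have distance at least `1` from `t₀`.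
  have hsub : Metric.sphere s₀ R ×ˢ Metric.closedBall t₀ (1 / 2) ⊆ {p : ℂ × ℂ | p.1 ≠ p.2} := by
    rintro ⟨s, t⟩ ⟨hs, ht⟩ (hst : s = t)
    subst hst
    simp only [mem_sphere_iff_norm, mem_closedBall_iff_norm] at hs ht
    have : ‖s - s₀‖ ≤ ‖s - t₀‖ + ‖s₀ - t₀‖ := by
      rw [← norm_neg (s₀ - t₀)]
      refine le_trans (le_of_eq ?_) (norm_add_le _ _)
      congr 1; ring
    linarith
  have hu := ((tendstoLocallyUniformlyOn_iff_forall_isCompact isOpen_offDiagonal).1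
    tendstoLocallyUniformlyOn_edgeSumTwo _ hsub hK).uniformCauchySeqOn
  rw [Metric.uniformCauchySeqOn_iff] at hu ⊢
  intro ε hε
  obtain ⟨n₀, hn₀⟩ := hu (ε / 2) (half_pos hε)
  refine ⟨n₀, fun m hm n hn p hp => ?_⟩
  obtain ⟨s, t⟩ := p
  have hmax := norm_le_of_forall_mem_frontier_norm_le (f := fun s =>
    edgeSumTwo m (s, t) - edgeSumTwo n (s, t)) (U := Metric.ball s₀ R) (C := ε / 2)
    Metric.isBounded_ball (((differentiable_edgeSumTwo_left m t).sub
      (differentiable_edgeSumTwo_left n t)).diffContOnCl) (fun z hz => ?_) (z := s) ?_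
  · rw [dist_eq_norm]
    linarith
  · rw [frontier_ball _ hR0.ne'] at hz
    rw [← dist_eq_norm]
    exact (hn₀ m hm n hn (z, t) ⟨hz, hp.2⟩).le
  · rw [closure_ball _ hR0.ne']
    exact hp.1

/-- The limit of the normalized sums extends `airyKernelTwoC` continuously. -/
theorem exists_limit_edgeSumTwo : ∃ B : ℂ × ℂ → ℂ, Continuous B ∧
    (∀ p, Tendsto (fun N => edgeSumTwo N p) atTop (𝓝 (B p))) ∧
    ∀ s t, s ≠ t → B (s, t) = airyKernelTwoC s t := by
  have hmem : ∀ p : ℂ × ℂ, Metric.closedBall p.1 (‖p.1 - p.2‖ + 1) ×ˢ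
      Metric.closedBall p.2 (1 / 2) ∈ 𝓝 p := fun p =>
    prod_mem_nhds (Metric.closedBall_mem_nhds _ (by positivity))
      (Metric.closedBall_mem_nhds _ (by norm_num))
  have hex : ∀ p : ℂ × ℂ, ∃ b, Tendsto (fun N => edgeSumTwo N p) atTop (𝓝 b) := fun p =>
    cauchySeq_tendsto_of_complete
      ((uniformCauchySeqOn_edgeSumTwo p.1 p.2).cauchySeq (mem_of_mem_nhds (hmem p)))
  choose B hB using hex
  refine ⟨B, ?_, hB, fun s t hst => ?_⟩
  · have : TendstoLocallyUniformly edgeSumTwo B atTop := by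
      intro u hu p
      exact ⟨_, hmem p, (uniformCauchySeqOn_edgeSumTwo p.1 p.2).tendstoUniformlyOn_of_tendsto
        (fun x _ => hB x) u hu⟩
    exact this.continuous (Frequently.of_forall continuous_edgeSumTwo)
  · exact tendsto_nhds_unique (hB (s, t))
      (tendstoLocallyUniformlyOn_edgeSumTwo.tendsto_at (a := (s, t)) hst)

end KernelLimit

/-! ### Real arguments -/

section RealEdge

theorem edgePoint_eq {N : ℕ} (x : ℝ) : edgePoint N x = 2 * edgeRoot N ^ 3 + x / edgeRoot N := by
  have h : Real.sqrt N = edgeRoot N ^ 3 := by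
    rw [Real.sqrt_eq_rpow, edgeRoot, ← Real.rpow_natCast, ← Real.rpow_mul (Nat.cast_nonneg N)]
    norm_num
  rw [edgePoint, h, edgeRoot]

theorem edgeArg_ofReal_eq_edgePoint (N : ℕ) (s : ℝ) : edgeArg N s = (edgePoint N s : ℂ) := by
  rw [edgeArg_ofReal, edgePoint_eq]

/-- The part of the normalization which does not depend on the arguments. -/
def edgeScale (N : ℕ) : ℝ :=
  (Real.sqrt (2 * Real.pi) * edgeRoot N ^ 3 * Real.exp (2 * edgeRoot N ^ 6))⁻¹

/-- The exponential factor of the normalization. -/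
def edgeDamp (N : ℕ) (s : ℝ) : ℝ := Real.exp (-edgeRoot N ^ 2 * s)

theorem edgeScale_nonneg (N : ℕ) : 0 ≤ edgeScale N := by
  have : 0 ≤ edgeRoot N := Real.rpow_nonneg (Nat.cast_nonneg N) _
  unfold edgeScale
  positivity

theorem edgeNormalization_mul_factorial (N : ℕ) (s t : ℝ) :
    edgeNormalization N s t * N.factorial = edgeScale N * (edgeDamp N s * edgeDamp N t) := by
  have hf : (N.factorial : ℝ) ≠ 0 := by exact_mod_cast N.factorial_ne_zero
  have h3 : (N : ℝ) ^ (1 / 2 : ℝ) = edgeRoot N ^ 3 := by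
    rw [edgeRoot, ← Real.rpow_natCast, ← Real.rpow_mul (Nat.cast_nonneg N)]
    norm_num
  have h2 : (N : ℝ) ^ (1 / 3 : ℝ) = edgeRoot N ^ 2 := by
    rw [edgeRoot, ← Real.rpow_natCast, ← Real.rpow_mul (Nat.cast_nonneg N)]
    norm_num
  rw [edgeNormalization, edgeScale, edgeDamp, edgeDamp, h3, h2, edgeRoot_pow_six, Real.exp_add,
    ← Real.exp_add (-edgeRoot N ^ 2 * s),
    show -edgeRoot N ^ 2 * s + -edgeRoot N ^ 2 * t = -((s + t) * edgeRoot N ^ 2) by ring,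
    Real.exp_neg]
  simp only [mul_inv]
  field_simp

/-- The ratio between Stirling's approximation and the factorial. -/
def stirlingRatio (N : ℕ) : ℝ :=
  Real.sqrt (2 * Real.pi) * edgeRoot N ^ 3 * edgeRoot N ^ (6 * N) * Real.exp (-edgeRoot N ^ 6)
    / N.factorial

/-- The Christoffel–Darboux identities carry `N!`, whereas `edgeKappa` carries `edgeRoot N ^ (3 *
N)`; Stirling's formula reconciles the two. -/
theorem tendsto_stirlingRatio : Tendsto stirlingRatio atTop (𝓝 1) := by
  have h := (Asymptotics.isEquivalent_iff_tendsto_one (Eventually.of_forall fun n => by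
    exact_mod_cast n.factorial_ne_zero)).1 Stirling.factorial_isEquivalent_stirling.symm
  refine h.congr fun N => ?_
  have hs : Real.sqrt (2 * N * Real.pi) = Real.sqrt (2 * Real.pi) * edgeRoot N ^ 3 := by
    rw [show (2 : ℝ) * N * Real.pi = 2 * Real.pi * N by ring,
      Real.sqrt_mul (by positivity), Real.sqrt_eq_rpow N, edgeRoot, ← Real.rpow_natCast,
      ← Real.rpow_mul (Nat.cast_nonneg N)]
    norm_num
  simp only [Pi.div_apply, stirlingRatio]
  rw [hs, pow_mul, edgeRoot_pow_six, div_pow, ← Real.exp_nat_mul, mul_one, Real.exp_neg]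
  ring

theorem hermiteSumTwo_ofReal (n : ℕ) (x y : ℝ) :
    hermiteSumTwo n (x : ℂ) (y : ℂ) = ((hermiteSumTwo n x y : ℝ) : ℂ) := by
  simp [hermiteSumTwo, hermiteSum, hermiteProd, hermiteVal_ofReal]

/-- The common prefactor of the quantities derived from the normalized Hermite polynomials. -/
theorem edgeScale_eq {N : ℕ} (hN : 1 ≤ N) :
    edgeScale N = stirlingRatio N
      * (N.factorial * ((edgeKappa N)⁻¹ ^ 2 / edgeRoot N ^ 4)) := by
  have hq0 : 0 < edgeRoot N := by have := one_le_edgeRoot hN; linarith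
  have hf : (N.factorial : ℝ) ≠ 0 := by exact_mod_cast N.factorial_ne_zero
  have hpi : Real.sqrt (2 * Real.pi) ≠ 0 := by positivity
  have he : Real.exp (edgeRoot N ^ 6 / 2) ^ 2 = Real.exp (edgeRoot N ^ 6) := by
    rw [← Real.exp_nat_mul]; congr 1; push_cast; ring
  have he2 : Real.exp (2 * edgeRoot N ^ 6) = Real.exp (edgeRoot N ^ 6) ^ 2 := by
    rw [← Real.exp_nat_mul]; norm_num
  rw [edgeScale, stirlingRatio, edgeKappa, he2, Real.exp_neg, inv_pow, mul_pow, he]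
  field_simp
  ring

theorem edgeSumTwo_ofReal {N : ℕ} (hN : 1 ≤ N) (s t : ℝ) :
    edgeScale N * (edgeDamp N s * edgeDamp N t) * hermiteSumTwo N (edgePoint N s) (edgePoint N t)
      = stirlingRatio N * (edgeSumTwo N (s, t)).re := by
  have : edgeSumTwo N (s, t) = ((N.factorial * ((edgeKappa N)⁻¹ ^ 2 / edgeRoot N ^ 4)
      * (edgeDamp N s * edgeDamp N t)
      * hermiteSumTwo N (edgePoint N s) (edgePoint N t) : ℝ) : ℂ) := by
    simp only [edgeSumTwo, edgeArg_ofReal_eq_edgePoint, hermiteSumTwo_ofReal, edgeDamp]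
    push_cast
    rfl
  rw [this, Complex.ofReal_re, edgeScale_eq hN]
  ring

theorem hermiteEdge_ofReal (N : ℕ) (s : ℝ) :
    hermiteEdge N s
      = (((edgeKappa N)⁻¹ * (edgeDamp N s * hermiteVal N (edgePoint N s)) : ℝ) : ℂ) := by
  rw [hermiteEdge, edgeArg_ofReal_eq_edgePoint, hermiteVal_ofReal, edgeDamp]
  push_cast
  rfl

theorem hermiteSum_ofReal (n : ℕ) (x y : ℝ) :
    hermiteSum n (x : ℂ) (y : ℂ) = ((hermiteSum n x y : ℝ) : ℂ) := by
  simp [hermiteSum, hermiteProd, hermiteVal_ofReal]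

theorem tendsto_inv_edgeRoot_real : Tendsto (fun N : ℕ => (edgeRoot N)⁻¹) atTop (𝓝 0) :=
  tendsto_inv_atTop_zero.comp tendsto_edgeRoot

/-- In the scaling of the iterated sum, a single product is `hermiteEdge N s ^ 2` times a factor of
order `edgeRoot N ^ (-4)`. -/
theorem tendsto_edge_hermiteProd_self (s : ℝ) :
    Tendsto (fun N : ℕ => edgeScale N * (edgeDamp N s * edgeDamp N s)
      * hermiteProd N (edgePoint N s) (edgePoint N s)) atTop (𝓝 0) := by
  have hs : Tendsto (fun N : ℕ => (N, (s : ℂ))) atTop (atTop ×ˢ 𝓝 (s : ℂ)) :=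
    tendsto_id.prodMk tendsto_const_nhds
  have h := (Complex.continuous_re.tendsto _).comp (((tendsto_hermiteEdge s).comp hs).pow 2)
  have h2 := (tendsto_stirlingRatio.mul h).mul (tendsto_inv_edgeRoot_real.pow 4)
  rw [zero_pow four_ne_zero, mul_zero] at h2
  refine h2.congr' ?_
  filter_upwards [eventually_ge_atTop 1] with N hN
  have hq0 : 0 < edgeRoot N := by have := one_le_edgeRoot hN; linarith
  have hf := factorial_mul_hermiteProd N (edgePoint N s) (edgePoint N s)
  simp only [Function.comp, hermiteEdge_ofReal, ← Complex.ofReal_pow, Complex.ofReal_re]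
  rw [edgeScale_eq hN]
  field_simp
  linear_combination -(stirlingRatio N * edgeDamp N s ^ 2 * (edgeKappa N)⁻¹ ^ 2 * hf)

/-- By the diagonal Christoffel–Darboux formula, a simple sum is the convergent quantity `h'² - h
h''`, `h = hermiteEdge N`, times a factor of order `edgeRoot N ^ (-2)`. Hence shifting the length of
the iterated sum is harmless. -/
theorem tendsto_edge_hermiteSum_self (s : ℝ) :
    Tendsto (fun N : ℕ => edgeScale N * (edgeDamp N s * edgeDamp N s)
      * hermiteSum N (edgePoint N s) (edgePoint N s)) atTop (𝓝 0) := by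
  have hs : Tendsto (fun N : ℕ => (N, (s : ℂ))) atTop (atTop ×ˢ 𝓝 (s : ℂ)) :=
    tendsto_id.prodMk tendsto_const_nhds
  have h := (Complex.continuous_re.tendsto _).comp ((((tendsto_hermiteEdgeDer s).comp hs).pow 2).sub
    (((tendsto_hermiteEdge s).comp hs).mul ((tendsto_hermiteEdge_ode s).comp hs)))
  have h2 := (tendsto_stirlingRatio.mul h).mul (tendsto_inv_edgeRoot_real.pow 2)
  rw [zero_pow two_ne_zero, mul_zero] at h2
  refine h2.congr' ?_
  filter_upwards [eventually_ge_atTop 1] with N hN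
  have hq0 : 0 < edgeRoot N := by have := one_le_edgeRoot hN; linarith
  have hqC : (edgeRoot N : ℂ) ≠ 0 := Complex.ofReal_ne_zero.2 hq0.ne'
  have hN' : (N : ℂ) = (edgeRoot N : ℂ) ^ 6 := by exact_mod_cast (edgeRoot_pow_six N).symm
  have key : hermiteEdgeDer N s ^ 2 - hermiteEdge N s * (s * hermiteEdge N s
        + s / (edgeRoot N : ℂ) ^ 2 * hermiteEdgeDer N s)
      = ((N.factorial * ((edgeKappa N)⁻¹ ^ 2 / edgeRoot N ^ 2)
      * (edgeDamp N s * edgeDamp N s)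
      * hermiteSum N (edgePoint N s) (edgePoint N s) : ℝ) : ℂ) := by
    have hid := factorial_mul_hermiteSum_self N (edgeArg N s)
    have hsub : (s : ℂ) = edgeRoot N * (edgeArg N s - 2 * (edgeRoot N : ℂ) ^ 3) := by
      rw [edgeArg]; field_simp; ring
    have hd : ((edgeDamp N s : ℝ) : ℂ) = Complex.exp (-(edgeRoot N : ℂ) ^ 2 * s) := by
      rw [edgeDamp]; push_cast; rfl
    push_cast
    rw [← hermiteSum_ofReal, ← edgeArg_ofReal_eq_edgePoint, hd]
    simp only [hermiteEdge, hermiteEdgeDer]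
    rw [hN'] at hid
    generalize Complex.exp (-(edgeRoot N : ℂ) ^ 2 * s) = e at *
    generalize hermiteSum N (edgeArg N s) (edgeArg N s) = S at *
    generalize hermiteVal N (edgeArg N s) = a at *
    generalize hermiteDer N (edgeArg N s) = b at *
    generalize edgeArg N s = x at *
    generalize (edgeKappa N : ℂ)⁻¹ = k at *
    generalize (N.factorial : ℂ) = f at *
    generalize (edgeRoot N : ℂ) = q at *
    rw [hsub]
    field_simp
    linear_combination -(k ^ 2 * e ^ 2 * hid)
  simp only [Function.comp, key, Complex.ofReal_re]
  rw [edgeScale_eq hN]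
  field_simp

end RealEdge

/-! ### Comparison of neighbouring sums -/

section Comparison

variable (g₁ g₂ x y : ℝ)

theorem abs_mul_hermiteProd_le (j : ℕ) :
    |g₁ * g₂ * hermiteProd j x y|
      ≤ (g₁ * g₁ * hermiteProd j x x + g₂ * g₂ * hermiteProd j y y) / 2 := by
  have hf : (0 : ℝ) < j.factorial := by exact_mod_cast j.factorial_pos
  have h : ∀ u v : ℝ, |u * v / j.factorial| ≤ (u * u / j.factorial + v * v / j.factorial) / 2 := by
    intro u v
    rw [abs_div, abs_of_pos hf, ← add_div, div_right_comm]
    gcongr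
    rw [abs_le]
    constructor <;> nlinarith [sq_nonneg (u + v), sq_nonneg (u - v)]
  have := h (g₁ * hermiteVal j x) (g₂ * hermiteVal j y)
  unfold hermiteProd
  convert this using 2 <;> ring

theorem abs_mul_hermiteSum_le (n : ℕ) :
    |g₁ * g₂ * hermiteSum n x y|
      ≤ (g₁ * g₁ * hermiteSum n x x + g₂ * g₂ * hermiteSum n y y) / 2 := by
  simp only [hermiteSum, Finset.mul_sum, ← Finset.sum_add_distrib, Finset.sum_div]
  exact (Finset.abs_sum_le_sum_abs _ _).trans
    (Finset.sum_le_sum fun j _ => abs_mul_hermiteProd_le g₁ g₂ x y j)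

theorem abs_mul_hermiteSumTwo_le (n : ℕ) :
    |g₁ * g₂ * hermiteSumTwo n x y|
      ≤ (g₁ * g₁ * hermiteSumTwo n x x + g₂ * g₂ * hermiteSumTwo n y y) / 2 := by
  simp only [hermiteSumTwo, Finset.mul_sum, ← Finset.sum_add_distrib, Finset.sum_div]
  exact (Finset.abs_sum_le_sum_abs _ _).trans
    (Finset.sum_le_sum fun j _ => abs_mul_hermiteSum_le g₁ g₂ x y j)

theorem hermiteProd_self_nonneg (j : ℕ) : 0 ≤ hermiteProd j x x :=
  div_nonneg (mul_self_nonneg _) (Nat.cast_nonneg _)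

theorem hermiteSum_self_nonneg (n : ℕ) : 0 ≤ hermiteSum n x x :=
  Finset.sum_nonneg fun j _ => hermiteProd_self_nonneg x j

theorem monotone_hermiteSum_self : Monotone fun n => hermiteSum n x x :=
  monotone_nat_of_le_succ fun n => by
    rw [hermiteSum_succ]; exact le_add_of_nonneg_right (hermiteProd_self_nonneg x n)

theorem monotone_hermiteSumTwo_self : Monotone fun n => hermiteSumTwo n x x :=
  monotone_nat_of_le_succ fun n => by
    rw [hermiteSumTwo_succ]; exact le_add_of_nonneg_right (hermiteSum_self_nonneg x n)

/-- Each of the `k` steps adds one simple sum of length at most `M`, bounded by its diagonal values,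
which increase with the length. -/
theorem abs_mul_hermiteSumTwo_sub_le {m k M : ℕ} (hM : m + k ≤ M + 1) :
    |g₁ * g₂ * hermiteSumTwo (m + k) x y - g₁ * g₂ * hermiteSumTwo m x y|
      ≤ k * ((g₁ * g₁ * hermiteSum M x x + g₂ * g₂ * hermiteSum M y y) / 2) := by
  induction k with
  | zero => simp
  | succ k ih =>
    have h1 := ih (by omega)
    have h2 := abs_mul_hermiteSum_le g₁ g₂ x y (m + k)
    have h3 := monotone_hermiteSum_self x (show m + k ≤ M by omega)
    have h4 := monotone_hermiteSum_self y (show m + k ≤ M by omega)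
    have h5 := mul_le_mul_of_nonneg_left h3 (mul_self_nonneg g₁)
    have h6 := mul_le_mul_of_nonneg_left h4 (mul_self_nonneg g₂)
    rw [← add_assoc, hermiteSumTwo_succ, mul_add, add_sub_right_comm]
    refine (abs_add_le _ _).trans ?_
    push_cast
    simp only at h5 h6
    linarith

end Comparison

/-! ### The kernel on the real plane -/

section RealKernel

theorem airyKernelTwoC_ofReal (s t : ℝ) :
    airyKernelTwoC s t = (airyKernelTwoFormula s t : ℂ) := by
  rw [airyKernelTwoC, airyKernelTwoFormula, airyC_ofReal, airyC_ofReal, deriv_airyC_ofReal,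
    deriv_airyC_ofReal]
  push_cast
  ring

theorem neBot_nhdsWithin_offDiagonal (x : ℝ) : (𝓝[{p : ℝ × ℝ | p.1 ≠ p.2}] (x, x)).NeBot := by
  rw [← mem_closure_iff_nhdsWithin_neBot]
  refine mem_closure_of_tendsto (f := fun n : ℕ => (x + 1 / ((n : ℝ) + 1), x)) (b := atTop) ?_
    (Eventually.of_forall fun n => ?_)
  · refine Tendsto.prodMk_nhds ?_ tendsto_const_nhds
    simpa using tendsto_one_div_add_atTop_nhds_zero_nat.const_add x
  · have : (0 : ℝ) < 1 / ((n : ℝ) + 1) := by positivity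
    simp only [Set.mem_ofPred_eq]
    linarith

/-- A continuous extension of the explicit formula is the kernel itself. -/
theorem airyKernelTwo_eq_of_continuous {B : ℝ × ℝ → ℝ} (hB : Continuous B)
    (h : ∀ s t, s ≠ t → B (s, t) = airyKernelTwoFormula s t) (s t : ℝ) :
    airyKernelTwo s t = B (s, t) := by
  unfold airyKernelTwo
  split_ifs with hst
  · subst hst
    have := neBot_nhdsWithin_offDiagonal s
    refine Tendsto.limUnder_eq ((hB.continuousWithinAt.tendsto).congr' ?_)
    filter_upwards [self_mem_nhdsWithin] with p hp
    exact h p.1 p.2 hp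
  · exact (h s t hst).symm

/-- The complex limit restricted to real points is a continuous extension of the explicit formula,
which identifies the diagonal values defined through `limUnder`. -/
theorem exists_real_limit_edgeSumTwo : ∃ B : ℝ × ℝ → ℝ, Continuous B ∧
    (∀ s t, airyKernelTwo s t = B (s, t)) ∧
    ∀ s t : ℝ, Tendsto (fun N => (edgeSumTwo N (s, t)).re) atTop (𝓝 (B (s, t))) := by
  obtain ⟨B, hB, hlim, hne⟩ := exists_limit_edgeSumTwo
  have hBr : Continuous fun p : ℝ × ℝ => (B (p.1, p.2)).re :=
    Complex.continuous_re.comp (hB.comp (by fun_prop))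
  refine ⟨fun p => (B (p.1, p.2)).re, hBr, airyKernelTwo_eq_of_continuous hBr fun s t hst => ?_,
    fun s t => (Complex.continuous_re.tendsto _).comp (hlim _)⟩
  rw [hne _ _ (by exact_mod_cast hst), airyKernelTwoC_ofReal, Complex.ofReal_re]

theorem continuous_airyKernelTwo : Continuous fun p : ℝ × ℝ => airyKernelTwo p.1 p.2 := by
  obtain ⟨B, hB, h, -⟩ := exists_real_limit_edgeSumTwo
  simpa only [h] using hB

theorem hasDerivAt_airyKernel_right {x y : ℝ} (h : x ≠ y) :
    HasDerivAt (fun t => airyKernel x t)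
      (((airyAi x * (y * airyAi y) - airyAiDeriv x * airyAiDeriv y) * (x - y)
        + (airyAi x * airyAiDeriv y - airyAiDeriv x * airyAi y)) / (x - y) ^ 2) y := by
  refine ((((hasDerivAt_airyAiDeriv y).const_mul (airyAi x)).sub
    ((hasDerivAt_airyAi y).const_mul (airyAiDeriv x))).div ((hasDerivAt_id y).const_sub x)
    (sub_ne_zero.2 h)).congr_deriv ?_
  simp only [id, Pi.sub_apply]
  ring

theorem hasDerivAt_airyKernel_left {x y : ℝ} (h : x ≠ y) :
    HasDerivAt (fun s => airyKernel s y)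
      (((airyAiDeriv x * airyAiDeriv y - x * airyAi x * airyAi y) * (x - y)
        - (airyAi x * airyAiDeriv y - airyAiDeriv x * airyAi y)) / (x - y) ^ 2) x := by
  refine ((((hasDerivAt_airyAi x).mul_const (airyAiDeriv y)).sub
    ((hasDerivAt_airyAiDeriv x).mul_const (airyAi y))).div ((hasDerivAt_id x).sub_const y)
    (sub_ne_zero.2 h)).congr_deriv ?_
  simp only [id, Pi.sub_apply]
  ring

theorem airyKernelTwo_eq_deriv {x y : ℝ} (h : x ≠ y) :
    airyKernelTwo x y = 1 / (x - y)
      * (deriv (fun t => airyKernel x t) y - deriv (fun s => airyKernel s y) x) := by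
  have hne := sub_ne_zero.2 h
  rw [(hasDerivAt_airyKernel_right h).deriv, (hasDerivAt_airyKernel_left h).deriv, airyKernelTwo,
    if_neg h, airyKernelTwoFormula]
  field_simp
  ring

end RealKernel

/-! ### The edge limit -/

section EdgeLimit

theorem tendsto_edge_hermiteSumTwo (s t : ℝ) :
    Tendsto (fun N : ℕ => edgeScale N * (edgeDamp N s * edgeDamp N t)
      * hermiteSumTwo N (edgePoint N s) (edgePoint N t)) atTop (𝓝 (airyKernelTwo s t)) := by
  obtain ⟨B, -, h, hlim⟩ := exists_real_limit_edgeSumTwo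
  have := tendsto_stirlingRatio.mul (hlim s t)
  rw [one_mul, ← h] at this
  refine this.congr' ?_
  filter_upwards [eventually_ge_atTop 1] with N hN
  exact (edgeSumTwo_ofReal hN s t).symm

/-- Bounds the effect of changing the number of terms of an edge sum by one. -/
def edgeIncrement (N : ℕ) (s t : ℝ) : ℝ :=
  (edgeScale N * (edgeDamp N s * edgeDamp N s) * hermiteSum (N + 1) (edgePoint N s) (edgePoint N s)
    + edgeScale N * (edgeDamp N t * edgeDamp N t)
      * hermiteSum (N + 1) (edgePoint N t) (edgePoint N t)) / 2

theorem tendsto_edgeIncrement (s t : ℝ) :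
    Tendsto (fun N => edgeIncrement N s t) atTop (𝓝 0) := by
  have h : ∀ s, Tendsto (fun N : ℕ => edgeScale N * (edgeDamp N s * edgeDamp N s)
      * hermiteSum (N + 1) (edgePoint N s) (edgePoint N s)) atTop (𝓝 0) := fun s => by
    have := (tendsto_edge_hermiteSum_self s).add (tendsto_edge_hermiteProd_self s)
    rw [add_zero] at this
    refine this.congr fun N => ?_
    rw [hermiteSum_succ]
    ring
  simpa [edgeIncrement] using ((h s).add (h t)).div_const 2

theorem abs_edge_hermiteSumTwo_sub_le (N m k : ℕ) (h : m + k ≤ N + 2) (s t : ℝ) :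
    |edgeScale N * (edgeDamp N s * edgeDamp N t)
        * hermiteSumTwo (m + k) (edgePoint N s) (edgePoint N t)
      - edgeScale N * (edgeDamp N s * edgeDamp N t)
        * hermiteSumTwo m (edgePoint N s) (edgePoint N t)|
      ≤ k * edgeIncrement N s t := by
  have := mul_le_mul_of_nonneg_left (abs_mul_hermiteSumTwo_sub_le (edgeDamp N s) (edgeDamp N t)
    (edgePoint N s) (edgePoint N t) (M := N + 1) h) (edgeScale_nonneg N)
  rw [← abs_of_nonneg (edgeScale_nonneg N), ← abs_mul, abs_of_nonneg (edgeScale_nonneg N)] at this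
  refine (le_of_eq ?_).trans (this.trans (le_of_eq ?_))
  · congr 1; ring
  · rw [edgeIncrement]; ring

/-- The bound is independent of `m`, hence dominates all terms of `corrPoly` simultaneously; its
value converges as `N → ∞`. -/
theorem abs_edge_hermiteSumTwo_le (N m : ℕ) (h : m ≤ N + 2) (s t : ℝ) :
    |edgeScale N * (edgeDamp N s * edgeDamp N t)
        * hermiteSumTwo m (edgePoint N s) (edgePoint N t)|
      ≤ (edgeScale N * (edgeDamp N s * edgeDamp N s)
            * hermiteSumTwo (N + 2) (edgePoint N s) (edgePoint N s)
          + edgeScale N * (edgeDamp N t * edgeDamp N t)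
            * hermiteSumTwo (N + 2) (edgePoint N t) (edgePoint N t)) / 2 := by
  have h0 := edgeScale_nonneg N
  have h1 := mul_le_mul_of_nonneg_left (abs_mul_hermiteSumTwo_le (edgeDamp N s) (edgeDamp N t)
    (edgePoint N s) (edgePoint N t) m) h0
  have h2 := mul_le_mul_of_nonneg_left (mul_le_mul_of_nonneg_left
    (monotone_hermiteSumTwo_self (edgePoint N s) h) (mul_self_nonneg (edgeDamp N s))) h0
  have h3 := mul_le_mul_of_nonneg_left (mul_le_mul_of_nonneg_left
    (monotone_hermiteSumTwo_self (edgePoint N t) h) (mul_self_nonneg (edgeDamp N t))) h0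
  rw [mul_assoc, abs_mul, abs_of_nonneg h0]
  simp only at h2 h3
  linarith

theorem tendsto_edge_hermiteSumTwo_add_two (s t : ℝ) :
    Tendsto (fun N : ℕ => edgeScale N * (edgeDamp N s * edgeDamp N t)
      * hermiteSumTwo (N + 2) (edgePoint N s) (edgePoint N t)) atTop (𝓝 (airyKernelTwo s t)) := by
  have h : Tendsto (fun N : ℕ => edgeScale N * (edgeDamp N s * edgeDamp N t)
        * hermiteSumTwo (N + 2) (edgePoint N s) (edgePoint N t)
      - edgeScale N * (edgeDamp N s * edgeDamp N t)
        * hermiteSumTwo N (edgePoint N s) (edgePoint N t)) atTop (𝓝 0) := by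
    refine squeeze_zero_norm (fun N => abs_edge_hermiteSumTwo_sub_le N N 2 le_rfl s t) ?_
    simpa using (tendsto_edgeIncrement s t).const_mul ((2 : ℕ) : ℝ)
  simpa using h.add (tendsto_edge_hermiteSumTwo s t)

theorem tendsto_edge_hermiteSumTwo_sub (k : ℕ) (s t : ℝ) :
    Tendsto (fun N : ℕ => edgeScale N * (edgeDamp N s * edgeDamp N t)
      * hermiteSumTwo (N + 2 - 2 * k) (edgePoint N s) (edgePoint N t)) atTop
      (𝓝 (airyKernelTwo s t)) := by
  have h : Tendsto (fun N : ℕ => edgeScale N * (edgeDamp N s * edgeDamp N t)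
        * hermiteSumTwo (N + 2) (edgePoint N s) (edgePoint N t)
      - edgeScale N * (edgeDamp N s * edgeDamp N t)
        * hermiteSumTwo (N + 2 - 2 * k) (edgePoint N s) (edgePoint N t)) atTop (𝓝 0) := by
    refine squeeze_zero_norm' (a := fun N => ((2 * k : ℕ) : ℝ) * edgeIncrement N s t) ?_ ?_
    -- For these `N` the subtraction in the index is not truncated.
    · filter_upwards [eventually_ge_atTop (2 * k)] with N hN
      have := abs_edge_hermiteSumTwo_sub_le N (N + 2 - 2 * k) (2 * k) (by omega) s t
      rwa [show N + 2 - 2 * k + 2 * k = N + 2 by omega] at this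
    · simpa using (tendsto_edgeIncrement s t).const_mul ((2 * k : ℕ) : ℝ)
  simpa using (tendsto_edge_hermiteSumTwo_add_two s t).sub h

/-- Dominated convergence for series: each rescaled iterated sum tends to the same kernel value, so
only the exponential series of the coefficients remains. -/
theorem tendsto_edge_corrPoly (a s t : ℝ) :
    Tendsto (fun N : ℕ => edgeScale N * (edgeDamp N s * edgeDamp N t)
      * corrPoly a N (edgePoint N s) (edgePoint N t)) atTop
      (𝓝 (Real.exp a * airyKernelTwo s t)) := by
  have hexp : HasSum (fun k : ℕ => a ^ k / k.factorial) (Real.exp a) := by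
    rw [Real.exp_eq_exp_ℝ]
    exact NormedSpace.expSeries_div_hasSum_exp a
  have hsum : ∀ N : ℕ, edgeScale N * (edgeDamp N s * edgeDamp N t)
      * corrPoly a N (edgePoint N s) (edgePoint N t)
      = ∑' k : ℕ, a ^ k / k.factorial * (edgeScale N * (edgeDamp N s * edgeDamp N t)
        * hermiteSumTwo (N + 2 - 2 * k) (edgePoint N s) (edgePoint N t)) := by
    intro N
    rw [tsum_eq_sum (s := Finset.range (N + 1)) fun k hk => ?_, corrPoly, Finset.mul_sum]
    · exact Finset.sum_congr rfl fun k _ => by ring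
    · have hk' : N + 1 ≤ k := by simpa using hk
      obtain h0 | h0 : N + 2 - 2 * k = 0 ∨ N + 2 - 2 * k = 1 := by omega
      all_goals simp [h0]
  simp only [hsum]
  rw [← hexp.tsum_eq, ← tsum_mul_right]
  have hdom := ((tendsto_edge_hermiteSumTwo_add_two s s).add
    (tendsto_edge_hermiteSumTwo_add_two t t)).div_const 2
  -- The limit of the diagonal bound plus one, so that it eventually dominates uniformly in `k`.
  set C := (airyKernelTwo s s + airyKernelTwo t t) / 2 + 1
  refine tendsto_tsum_of_dominated_convergence (bound := fun k : ℕ => |a| ^ k / k.factorial * C)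
    ((Real.summable_pow_div_factorial |a|).mul_right C)
    (fun k => (tendsto_edge_hermiteSumTwo_sub k s t).const_mul _) ?_
  filter_upwards [hdom.eventually_le_const (lt_add_one _)] with N hN k
  rw [norm_mul, norm_div, norm_pow, Real.norm_eq_abs, Real.norm_natCast, Real.norm_eq_abs]
  gcongr
  exact (abs_edge_hermiteSumTwo_le N _ (Nat.sub_le _ _) s t).trans hN

end EdgeLimit

end

theorem theorem2
    (Q : Measure ℝ) [IsProbabilityMeasure Q]
    (hmean : ∫ x, x ∂Q = 0)
    (hvar : ∫ x, x ^ 2 ∂Q = 1)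
    (hfourth : Integrable (fun x : ℝ => x ^ 4) Q)
    (Ω : ℕ → Type*) [∀ N, MeasurableSpace (Ω N)]
    (P : ∀ N, Measure (Ω N)) [∀ N, IsProbabilityMeasure (P N)]
    (ξ : ∀ N, Fin N → Fin N → Ω N → ℝ)
    (hξ : ∀ N, IsIIDUpperTriangle (P N) Q (ξ N)) :
    (∀ (N : ℕ) (μ ν : ℝ),
      Integrable (fun ω => wignerCharDet (ξ N) μ ω * wignerCharDet (ξ N) ν ω) (P N)) ∧
    (∀ μ ν : ℝ,
      Tendsto
        (fun N : ℕ => edgeNormalization N μ ν *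
          corrFun (P N) (ξ N) (edgePoint N μ) (edgePoint N ν))
        atTop
        (𝓝 (Real.exp (((∫ x, x ^ 4 ∂Q) - 3) / 2) * airyKernelTwo μ ν))) ∧
    Continuous (fun p : ℝ × ℝ => airyKernelTwo p.1 p.2) ∧
    (∀ x y : ℝ, x ≠ y →
      airyKernelTwo x y =
        1 / (x - y) *
          (deriv (fun t => airyKernel x t) y - deriv (fun s => airyKernel s y) x)) := by
  refine ⟨fun N μ ν => ?_, fun μ ν => ?_, continuous_airyKernelTwo,
    fun x y h => airyKernelTwo_eq_deriv h⟩
  · obtain ⟨ξ', hξ', hm, hae⟩ := exists_measurable_modification (hξ N)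
    refine (integrable_wignerCharDet_mul hfourth hξ' hm μ ν).congr ?_
    filter_upwards [hae] with ω hω
    rw [hω, hω]
  · refine (tendsto_edge_corrPoly _ μ ν).congr fun N => ?_
    obtain ⟨ξ', hξ', hm, hae⟩ := exists_measurable_modification (hξ N)
    have hcorr : corrFun (P N) (ξ N) (edgePoint N μ) (edgePoint N ν) =
        corrFun (P N) ξ' (edgePoint N μ) (edgePoint N ν) := by
      refine integral_congr_ae ?_
      filter_upwards [hae] with ω hω
      rw [hω, hω]
    rw [hcorr, corrFun_eq_corrPoly hmean hvar hfourth N ξ' hξ' hm]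
    dsimp only
    rw [← mul_assoc (edgeNormalization N μ ν), edgeNormalization_mul_factorial]
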